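/- Let $n\in\mathbb N$, $1<p,q<\infty$, $\frac1p+\frac1{p'}=\frac1q+\frac1{q'}=1$, $-\frac np<r<0$ and $r+\varrho=-n$. For $J\in\mathbb Z$, $M\in\mathbb Z^n$ let $Q_{J,M}=2^{-J}(M+[-1,1]^n)$. All functions are complex-valued and functions equal almost everywhere are identified. The Morrey space $L^r_p(\ell_q,\mathbb R^n)$ consists of all sequences $\{g_j\}_{j\ge0}$ of functions in $L_p^{\mathrm{loc}}(\mathbb R^n)$ with $$\|g_j|L^r_p(\ell_q,\mathbb R^n)\|=\sup_{J\in\mathbb Z,M\in\mathbb Z^n}2^{J(\frac np+r)}\Big\|\Big(\sum_{j\ge0}|g_j(\cdot)|^q\Big)^{1/q}\Big|L_p(Q_{J,M})\Big\|<\infty .$$ $H^\varrho L_{p'}(\mathbb R^n)$ is the space of all $h\in S'(\mathbb R^n)$ with $h=\sum_{J,M}\lambda_{J,M}a_{J,M}$ in $S'(\mathbb R^n)$, $\operatorname{supp}a_{J,M}\subset Q_{J,M}$, $\|a_{J,M}|L_{p'}(\mathbb R^n)\|\le2^{-J(\frac n{p'}+\varrho)}$ and $\sum_{J,M}|\lambda_{J,M}|<\infty$,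 normed by the infimum of $\sum_{J,M}|\lambda_{J,M}|$ over all such representations; its elements are regular distributions. $H^\varrho L_{p'}(\ell_{q'},\mathbb R^n)$ is the space of all sequences $\{f_j\}_{j\ge0}$ in $H^\varrho L_{p'}(\mathbb R^n)$ such that $\|f_j(\cdot)|\ell_{q'}\|=\big(\sum_j|f_j(\cdot)|^{q'}\big)^{1/q'}$ belongs to $H^\varrho L_{p'}(\mathbb R^n)$, with the norm of that function. For $\alpha\in\mathbb R$, $L_{p'}(\ell_{q'},w_\alpha,\mathbb R^n)$ is the space of all sequences $\{f_j\}_{j\ge 0}$ of measurable functions with $\big\|(1+|\cdot|^2)^{\alpha/2}\,\|f_j(\cdot)|\ell_{q'}\|\,\big|L_{p'}(\mathbb R^n)\big\|<\infty$, normed by this number. Then $H^\varrho L_{p'}(\ell_{q'},\mathbb R^n)$ is a predual of $L^r_p(\ell_q,\mathbb R^n)$: it is a Banach space, the integral $$\langle g,f\rangle=\int_{\mathbb R^n}\sum_{j\ge0}g_j(x)f_j(x)\,dx$$ converges absolutely for all $g\in L^r_p(\ell_q,\mathbb R^n)$ and $f\in H^\varrho L_{p'}(\ell_{q'},\mathbb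 R^n)$, and $g\mapsto\langle g,\cdot\rangle$ is a linear isometry of $L^r_p(\ell_q,\mathbb R^n)$ onto the dual of $H^\varrho L_{p'}(\ell_{q'},\mathbb R^n)$. Moreover, let $\alpha>n/p$. Then $L_{p'}(\ell_{q'},w_\alpha,\mathbb R^n)$ is continuously embedded in $H^\varrho L_{p'}(\ell_{q'},\mathbb R^n)$. For every bounded linear functional $T$ on $H^\varrho L_{p'}(\ell_{q'},\mathbb R^n)$ there is a unique $g\in L^r_p(\ell_q,\mathbb R^n)$ with $T(f)=\langle g,f\rangle$ for all $f\in L_{p'}(\ell_{q'},w_\alpha,\mathbb R^n)$; conversely, for every $g\in L^r_p(\ell_q,\mathbb R^n)$ there is a unique bounded linear functional $T$ on $H^\varrho L_{p'}(\ell_{q'},\mathbb R^n)$ with this property; and then $\|T\|=\|g_j|L^r_p(\ell_q,\mathbb R^n)\|$. Finally, for every $g=\{g_j\}\in L^r_p(\ell_q,\mathbb R^n)$, $$\|g_j|L^r_p(\ell_q,\mathbb R^n)\|=\sup\big\{|\langle g,f\rangle| : f\in H^\varrho L_{p'}(\ell_{q'},\mathbb R^n),\ \|f|H^\varrho L_{p'}(\ell_{q'},\mathbb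 R^n)\|\le1\big\}.$$ -/

import Mathlib

noncomputable section

namespace MorreyDual

open MeasureTheory SchwartzMap
open scoped ENNReal

/-- Euclidean `n`-space. -/
abbrev Rn (n : ℕ) : Type := EuclideanSpace ℝ (Fin n)

/-- Indices `(J, M)` with `J ∈ ℤ` and `M ∈ ℤⁿ`. -/
abbrev Idx (n : ℕ) : Type := ℤ × (Fin n → ℤ)

/-- The cube `Q_{J,M} = 2^{-J} (M + [-1,1]^n)`. -/
def cube {n : ℕ} (i : Idx n) : Set (Rn n) :=
  {x | ∀ k, x k ∈ Set.Icc ((2 : ℝ) ^ (-i.1) * (i.2 k - 1)) ((2 : ℝ) ^ (-i.1) * (i.2 k + 1))}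

/-- The number `2 ^ (J s)`. -/
def scale (J : ℤ) (s : ℝ) : ℝ≥0∞ := ENNReal.ofReal ((2 : ℝ) ^ ((J : ℝ) * s))

/-- The pointwise `ℓ_q` norm `(∑_j |f_j(x)|^q)^{1/q} ∈ [0,∞]` of a sequence of functions. -/
def lqNorm {n : ℕ} (q : ℝ) (f : ℕ → Rn n →ₘ[volume] ℂ) (x : Rn n) : ℝ≥0∞ :=
  (∑' j, ‖f j x‖ₑ ^ q) ^ (1 / q)

/-! ### Morrey spaces -/

/-- The Morrey norm `sup_{J,M} 2^{J(n/p+r)} ‖F | L_p(Q_{J,M})‖ ∈ [0,∞]`. -/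
def morreyNorm {n : ℕ} {ε : Type*} [ENorm ε] (p r : ℝ) (F : Rn n → ε) : ℝ≥0∞ :=
  ⨆ i : Idx n, scale i.1 (n / p + r) *
    eLpNorm F (ENNReal.ofReal p) (volume.restrict (cube i))

/-- Membership in the scalar Morrey space `L_p^r(ℝⁿ)`: locally `p`-integrable (that is, in
`L_p(K)` for every bounded measurable `K`) with finite Morrey norm. -/
def IsMorrey {n : ℕ} (p r : ℝ) (f : Rn n →ₘ[volume] ℂ) : Prop :=
  (∀ K : Set (Rn n), MeasurableSet K → Bornology.IsBounded K →
    MemLp f (ENNReal.ofReal p) (volume.restrict K)) ∧ morreyNorm p r f < ∞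

/-- Membership in `L_p^r(ℓ_q, ℝⁿ)`. -/
def IsMorreySeq {n : ℕ} (p q r : ℝ) (f : ℕ → Rn n →ₘ[volume] ℂ) : Prop :=
  (∀ j, IsMorrey p r (f j)) ∧ morreyNorm p r (lqNorm q f) < ∞

/-! ### Predual Morrey spaces -/

/-- `h = ∑ c_{J,M} a_{J,M}` in `𝓢'(ℝⁿ)` (the topology of `𝓢'` is that of pointwise convergence),
with `supp a_{J,M} ⊆ Q_{J,M}`, `‖a_{J,M} | L_p‖ ≤ 2^{-J(n/p+ρ)}` and `∑ |c_{J,M}| < ∞`. -/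
structure IsAtomicRep {n : ℕ} (p ρ : ℝ) (h : 𝓢'(Rn n, ℂ)) (c : Idx n → ℂ)
    (a : Idx n → Rn n → ℂ) : Prop where
  memLp : ∀ i, MemLp (a i) (ENNReal.ofReal p) volume
  supp : ∀ i, ∀ᵐ x, x ∉ cube i → a i x = 0
  norm_le : ∀ i, eLpNorm (a i) (ENNReal.ofReal p) volume ≤ scale i.1 (-(n / p + ρ))
  summable : Summable fun i => ‖c i‖
  hasSum : ∀ φ : 𝓢(Rn n, ℂ), HasSum (fun i => c i * ∫ x, φ x * a i x) (h φ)

/-- The norm `‖h | H^ρ L_p(ℝⁿ)‖` of a tempered distribution: the infimum of `∑ |c_{J,M}|` over all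
atomic representations of `h`. It is `∞` exactly if there are none, that is, if `h` is not
in `H^ρ L_p(ℝⁿ)`. -/
def predualNormDist {n : ℕ} (p ρ : ℝ) (h : 𝓢'(Rn n, ℂ)) : ℝ≥0∞ :=
  ⨅ (c : Idx n → ℂ) (a : Idx n → Rn n → ℂ) (_ : IsAtomicRep p ρ h c a), ∑' i, ‖c i‖ₑ

/-- `h` is the regular tempered distribution given by the function `F`. -/
structure IsRegular {n : ℕ} (h : 𝓢'(Rn n, ℂ)) (F : Rn n → ℂ) : Prop where
  aestronglyMeasurable : AEStronglyMeasurable F volume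
  integrable : ∀ φ : 𝓢(Rn n, ℂ), Integrable fun x => φ x * F x
  apply_eq : ∀ φ : 𝓢(Rn n, ℂ), h φ = ∫ x, φ x * F x

/-- The norm in `H^ρ L_p(ℝⁿ)` of a function, identified with its regular distribution; `∞` if the
function does not belong to `H^ρ L_p(ℝⁿ)`. -/
def predualNorm {n : ℕ} (p ρ : ℝ) (F : Rn n → ℂ) : ℝ≥0∞ :=
  ⨅ (h : 𝓢'(Rn n, ℂ)) (_ : IsRegular h F), predualNormDist p ρ h

/-- The norm `‖ ‖f_j(·) | ℓ_q‖ | H^ρ L_p(ℝⁿ)‖` as a number in `[0,∞]`. -/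
def predualSeqNorm {n : ℕ} (p q ρ : ℝ) (f : ℕ → Rn n →ₘ[volume] ℂ) : ℝ≥0∞ :=
  predualNorm p ρ (fun x => ((lqNorm q f x).toReal : ℂ))

/-- Membership in `H^ρ L_p(ℓ_q, ℝⁿ)`: every `f_j` is in `H^ρ L_p(ℝⁿ)`, and so is
`‖f_j(·) | ℓ_q‖` (which is finite almost everywhere). -/
def IsPredualSeq {n : ℕ} (p q ρ : ℝ) (f : ℕ → Rn n →ₘ[volume] ℂ) : Prop :=
  (∀ j, predualNorm p ρ (f j) < ∞) ∧ (∀ᵐ x, lqNorm q f x < ∞) ∧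
    predualSeqNorm p q ρ f < ∞

/-! ### Weighted Lebesgue spaces -/

/-- The norm `‖w_α F | L_p(ℝⁿ)‖ ∈ [0,∞]` with `w_α(x) = (1+|x|²)^{α/2}`. -/
def weightedNorm {n : ℕ} {ε : Type*} [ENorm ε] (p α : ℝ) (F : Rn n → ε) : ℝ≥0∞ :=
  eLpNorm (fun x => ENNReal.ofReal ((1 + ‖x‖ ^ 2) ^ (α / 2)) * ‖F x‖ₑ)
    (ENNReal.ofReal p) volume

/-- Membership in `L_p(ℓ_q, w_α, ℝⁿ)`. -/
def IsWeightedSeq {n : ℕ} (p q α : ℝ) (f : ℕ → Rn n →ₘ[volume] ℂ) : Prop :=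
  (∀ j, weightedNorm p α (f j) < ∞) ∧ weightedNorm p α (lqNorm q f) < ∞

/-- The ranges of the parameters for which `H^ρ L_p(ℓ_q, ℝⁿ)` is defined. -/
structure PredualParams (n : ℕ) (p q ρ : ℝ) : Prop where
  one_lt_p : 1 < p
  one_lt_q : 1 < q
  lt_ρ : -(n : ℝ) < ρ
  ρ_lt : ρ < -(n / p)

/-- The ranges of the parameters for which `L_p^r(ℓ_q, ℝⁿ)` is defined. -/
structure MorreyParams (n : ℕ) (p q r : ℝ) : Prop where
  one_lt_p : 1 < p
  one_lt_q : 1 < q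
  le_r : -(n / p) ≤ r
  r_lt : r < 0

/-! ### The cubes -/

section
variable {n : ℕ}

lemma scale_ne_zero (J : ℤ) (s : ℝ) : scale J s ≠ 0 := by
  unfold scale; simp; positivity

lemma scale_ne_top (J : ℤ) (s : ℝ) : scale J s ≠ ∞ := ENNReal.ofReal_ne_top

lemma scale_mul_scale_neg (J : ℤ) (s : ℝ) : scale J s * scale J (-s) = 1 := by
  unfold scale
  rw [← ENNReal.ofReal_mul (by positivity), ← Real.rpow_add (by norm_num)]
  simp

lemma cube_eq (i : Idx n) : cube i = (MeasurableEquiv.toLp 2 (Fin n → ℝ)).symm ⁻¹'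
    Set.Icc (fun k => (2 : ℝ) ^ (-i.1) * (i.2 k - 1)) (fun k => (2 : ℝ) ^ (-i.1) * (i.2 k + 1)) := by
  ext x
  simp [cube, Pi.le_def, forall_and]

lemma measurableSet_cube (i : Idx n) : MeasurableSet (cube i) := by
  rw [cube_eq]
  exact (MeasurableEquiv.toLp 2 (Fin n → ℝ)).symm.measurable measurableSet_Icc

lemma volume_cube (i : Idx n) :
    volume (cube i) = ENNReal.ofReal ((2 : ℝ) ^ ((1 - (i.1 : ℝ)) * n)) := by
  rw [cube_eq, (EuclideanSpace.volume_preserving_symm_measurableEquiv_toLp (Fin n)).measure_preimage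
    measurableSet_Icc.nullMeasurableSet, Real.volume_Icc_pi]
  have : ∀ k, (2 : ℝ) ^ (-i.1) * ((i.2 k : ℝ) + 1) - (2 : ℝ) ^ (-i.1) * ((i.2 k : ℝ) - 1)
      = (2 : ℝ) ^ (1 - (i.1 : ℝ)) := by
    intro k
    rw [Real.rpow_sub (by norm_num), Real.rpow_intCast, zpow_neg]
    simp; ring
  simp only [this, Finset.prod_const, Finset.card_univ, Fintype.card_fin]
  rw [← ENNReal.ofReal_pow (by positivity), ← Real.rpow_natCast, ← Real.rpow_mul (by norm_num)]

lemma exists_mem_cube (x : Rn n) : ∃ i : Idx n, x ∈ cube i := by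
  refine ⟨(0, fun k => ⌊x k⌋), fun k => ?_⟩
  have h1 := Int.floor_le (x k)
  have h2 := Int.lt_floor_add_one (x k)
  constructor <;> simp <;> linarith

end

/-! ### Properties of the `ℓ_q` norm -/

section
variable {n : ℕ}

lemma aemeasurable_lqNorm (q : ℝ) (f : ℕ → Rn n →ₘ[volume] ℂ) : AEMeasurable (lqNorm q f) := by
  unfold lqNorm
  refine AEMeasurable.pow_const (AEMeasurable.tsum fun j => ?_) _
  exact ((f j).aestronglyMeasurable.enorm).pow_const _

lemma lqNorm_add_le {q : ℝ} (hq : 1 < q) (f g : ℕ → Rn n →ₘ[volume] ℂ) :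
    ∀ᵐ x, lqNorm q (f + g) x ≤ lqNorm q f x + lqNorm q g x := by
  have h : ∀ᵐ x, ∀ j, (f j + g j : Rn n →ₘ[volume] ℂ) x = f j x + g j x :=
    ae_all_iff.2 fun j => AEEqFun.coeFn_add (f j) (g j)
  filter_upwards [h] with x hx
  have key := ENNReal.lintegral_Lp_add_le (μ := Measure.count) (p := q)
    (f := fun j : ℕ => ‖f j x‖ₑ) (g := fun j : ℕ => ‖g j x‖ₑ)
    (measurable_of_countable _).aemeasurable (measurable_of_countable _).aemeasurable hq.le
  simp only [lintegral_count] at key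
  refine le_trans ?_ key
  unfold lqNorm
  gcongr with j
  simp only [Pi.add_apply, hx j]
  exact enorm_add_le _ _

lemma lqNorm_smul {q : ℝ} (hq : 1 < q) (c : ℂ) (f : ℕ → Rn n →ₘ[volume] ℂ) :
    ∀ᵐ x, lqNorm q (c • f) x = ‖c‖ₑ * lqNorm q f x := by
  have h : ∀ᵐ x, ∀ j, (c • f j : Rn n →ₘ[volume] ℂ) x = c * f j x :=
    ae_all_iff.2 fun j => AEEqFun.coeFn_smul c (f j)
  filter_upwards [h] with x hx
  have hq0 : 0 < q := by linarith
  unfold lqNorm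
  simp only [Pi.smul_apply, hx, enorm_mul, ENNReal.mul_rpow_of_nonneg _ _ hq0.le,
    ENNReal.tsum_mul_left]
  rw [ENNReal.mul_rpow_of_nonneg _ _ (by positivity), ← ENNReal.rpow_mul,
    mul_one_div_cancel hq0.ne', ENNReal.rpow_one]

lemma lqNorm_zero {q : ℝ} (hq : 1 < q) :
    ∀ᵐ x, lqNorm q (0 : ℕ → Rn n →ₘ[volume] ℂ) x = 0 := by
  filter_upwards [lqNorm_smul hq 0 (0 : ℕ → Rn n →ₘ[volume] ℂ)] with x hx
  rw [show (0 : ℂ) • (0 : ℕ → Rn n →ₘ[volume] ℂ) = 0 from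
    funext fun _ => zero_smul ℂ (0 : Rn n →ₘ[volume] ℂ)] at hx
  simpa using hx

lemma enorm_le_lqNorm {q : ℝ} (hq : 1 < q) (f : ℕ → Rn n →ₘ[volume] ℂ) (j : ℕ) (x : Rn n) :
    ‖f j x‖ₑ ≤ lqNorm q f x := by
  have hq0 : 0 < q := by linarith
  unfold lqNorm
  calc ‖f j x‖ₑ = (‖f j x‖ₑ ^ q) ^ (1 / q) := by
        rw [← ENNReal.rpow_mul, mul_one_div_cancel hq0.ne', ENNReal.rpow_one]
    _ ≤ _ := by gcongr; exact ENNReal.le_tsum (f := fun j => ‖f j x‖ₑ ^ q) j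

lemma eq_zero_of_lqNorm_ae {q : ℝ} (hq : 1 < q) {f : ℕ → Rn n →ₘ[volume] ℂ}
    (hf : ∀ᵐ x, lqNorm q f x = 0) : f = 0 := by
  funext j
  refine AEEqFun.ext ?_
  filter_upwards [hf, AEEqFun.coeFn_zero (α := Rn n) (β := ℂ) (μ := volume)] with x hx h0
  have := enorm_le_lqNorm hq f j x
  rw [hx] at this
  simp only [Pi.zero_apply] at h0 ⊢
  rw [h0]
  simpa using this

end

/-! ### The Morrey space as a normed space -/

section
variable {n : ℕ} {ε ε₁ ε₂ : Type*} {p q r : ℝ}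

lemma morreyNorm_mono [ENorm ε₁] [ENorm ε₂] {F : Rn n → ε₁} {G : Rn n → ε₂}
    (h : ∀ᵐ x, ‖F x‖ₑ ≤ ‖G x‖ₑ) : morreyNorm p r F ≤ morreyNorm p r G := by
  unfold morreyNorm
  gcongr with i
  exact eLpNorm_mono_enorm_ae (ae_restrict_of_ae h)

lemma morreyNorm_add_le (hp : 1 < p) {F G : Rn n → ℝ≥0∞} (hF : AEMeasurable F)
    (hG : AEMeasurable G) :
    morreyNorm p r (F + G) ≤ morreyNorm p r F + morreyNorm p r G := by
  refine iSup_le fun i => ?_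
  refine (mul_le_mul_right (eLpNorm_add_le hF.restrict.aestronglyMeasurable
    hG.restrict.aestronglyMeasurable (by simpa using hp.le)) _).trans ?_
  rw [mul_add]
  exact add_le_add (le_iSup (fun i : Idx n => scale i.1 (n / p + r) *
    eLpNorm F (ENNReal.ofReal p) (volume.restrict (cube i))) i)
    (le_iSup (fun i : Idx n => scale i.1 (n / p + r) *
    eLpNorm G (ENNReal.ofReal p) (volume.restrict (cube i))) i)

lemma morreyNorm_const_mul_le (c : ℂ) (F : Rn n → ℝ≥0∞) :
    morreyNorm p r (fun x => ‖c‖ₑ * F x) ≤ ‖c‖ₑ * morreyNorm p r F := by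
  refine iSup_le fun i => ?_
  have := eLpNorm_le_nnreal_smul_eLpNorm_of_ae_le_mul' (μ := volume.restrict (cube i))
    (f := fun x => ‖c‖ₑ * F x) (g := F) (c := ‖c‖₊) (by simp [enorm_eq_nnnorm])
    (ENNReal.ofReal p)
  calc _ ≤ scale i.1 (n / p + r) * (‖c‖₊ • eLpNorm F (ENNReal.ofReal p)
          (volume.restrict (cube i))) := by gcongr
    _ = ‖c‖ₑ * (scale i.1 (n / p + r) * eLpNorm F (ENNReal.ofReal p)
          (volume.restrict (cube i))) := by
        rw [ENNReal.smul_def, smul_eq_mul, enorm_eq_nnnorm]; ring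
    _ ≤ _ := by
        gcongr
        exact le_iSup (fun i : Idx n => scale i.1 (n / p + r) *
          eLpNorm F (ENNReal.ofReal p) (volume.restrict (cube i))) i

lemma ae_eq_zero_of_morreyNorm (hp : 1 < p) {F : Rn n → ℝ≥0∞} (hF : AEMeasurable F)
    (h : morreyNorm p r F = 0) : ∀ᵐ x, F x = 0 := by
  have h1 : ∀ i : Idx n, ∀ᵐ x, x ∈ cube i → F x = 0 := by
    intro i
    rw [← ae_restrict_iff' (measurableSet_cube i)]
    have h2 := (ENNReal.iSup_eq_zero.1 h) i
    rw [mul_eq_zero, or_iff_right (scale_ne_zero _ _), eLpNorm_eq_zero_iff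
      hF.restrict.aestronglyMeasurable (by simp; linarith)] at h2
    exact h2
  filter_upwards [ae_all_iff.2 h1] with x hx
  obtain ⟨i, hi⟩ := exists_mem_cube x
  exact hx i hi

lemma IsMorrey.add (hp : 1 < p) {f g : Rn n →ₘ[volume] ℂ} (hf : IsMorrey p r f)
    (hg : IsMorrey p r g) : IsMorrey p r (f + g) := by
  refine ⟨fun K hK hb => ?_, ?_⟩
  · exact ((hf.1 K hK hb).add (hg.1 K hK hb)).ae_eq
      (ae_restrict_of_ae (AEEqFun.coeFn_add f g).symm)
  · calc morreyNorm p r (f + g : Rn n →ₘ[volume] ℂ)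
        ≤ morreyNorm p r ((fun x => ‖f x‖ₑ) + fun x => ‖g x‖ₑ) := by
          refine morreyNorm_mono ?_
          filter_upwards [AEEqFun.coeFn_add f g] with x hx
          rw [hx]
          simpa using enorm_add_le (f x) (g x)
      _ ≤ _ := morreyNorm_add_le hp f.aestronglyMeasurable.enorm g.aestronglyMeasurable.enorm
      _ < ∞ := by
          refine ENNReal.add_lt_top.2 ⟨(morreyNorm_mono ?_).trans_lt hf.2,
            (morreyNorm_mono ?_).trans_lt hg.2⟩ <;> simp

lemma IsMorrey.smul (c : ℂ) {f : Rn n →ₘ[volume] ℂ} (hf : IsMorrey p r f) :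
    IsMorrey p r (c • f) := by
  refine ⟨fun K hK hb => ?_, ?_⟩
  · exact ((hf.1 K hK hb).const_smul c).ae_eq
      (ae_restrict_of_ae (AEEqFun.coeFn_smul c f).symm)
  · calc morreyNorm p r (c • f : Rn n →ₘ[volume] ℂ)
        ≤ morreyNorm p r (fun x => ‖c‖ₑ * ‖f x‖ₑ) := by
          refine morreyNorm_mono ?_
          filter_upwards [AEEqFun.coeFn_smul c f] with x hx
          rw [hx]
          simp
      _ ≤ ‖c‖ₑ * morreyNorm p r (fun x => ‖f x‖ₑ) := morreyNorm_const_mul_le c _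
      _ < ∞ := by
          refine ENNReal.mul_lt_top (by simp) ((morreyNorm_mono ?_).trans_lt hf.2)
          simp

lemma isMorrey_zero : IsMorrey p r (0 : Rn n →ₘ[volume] ℂ) := by
  refine ⟨fun K hK hb => ?_, ?_⟩
  · exact (MemLp.zero (ε := ℂ)).ae_eq
      (ae_restrict_of_ae (AEEqFun.coeFn_zero (α := Rn n) (β := ℂ) (μ := volume)).symm)
  · refine lt_of_le_of_lt (morreyNorm_mono (G := fun _ => (0 : ℂ)) ?_) ?_
    · filter_upwards [AEEqFun.coeFn_zero (α := Rn n) (β := ℂ) (μ := volume)] with x hx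
      rw [hx]; simp
    · simp [morreyNorm]

lemma morreyNorm_lqNorm_add_le (hp : 1 < p) (hq : 1 < q) (f g : ℕ → Rn n →ₘ[volume] ℂ) :
    morreyNorm p r (lqNorm q (f + g)) ≤
      morreyNorm p r (lqNorm q f) + morreyNorm p r (lqNorm q g) :=
  (morreyNorm_mono (by simpa using lqNorm_add_le hq f g)).trans
    (morreyNorm_add_le hp (aemeasurable_lqNorm q f) (aemeasurable_lqNorm q g))

lemma morreyNorm_lqNorm_smul_le (hq : 1 < q) (c : ℂ) (f : ℕ → Rn n →ₘ[volume] ℂ) :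
    morreyNorm p r (lqNorm q (c • f)) ≤ ‖c‖ₑ * morreyNorm p r (lqNorm q f) := by
  refine (morreyNorm_mono ?_).trans (morreyNorm_const_mul_le c _)
  filter_upwards [lqNorm_smul hq c f] with x hx
  simp [hx]

lemma morreyNorm_lqNorm_zero (hq : 1 < q) :
    morreyNorm p r (lqNorm q (0 : ℕ → Rn n →ₘ[volume] ℂ)) = 0 := by
  have := morreyNorm_lqNorm_smul_le (p := p) (r := r) hq 0 (0 : ℕ → Rn n →ₘ[volume] ℂ)
  rw [show (0 : ℂ) • (0 : ℕ → Rn n →ₘ[volume] ℂ) = 0 from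
    funext fun _ => zero_smul ℂ (0 : Rn n →ₘ[volume] ℂ)] at this
  simpa using this

/-- The space `L_p^r(ℓ_q, ℝⁿ)`. -/
def MorreySpace (h : MorreyParams n p q r) : Submodule ℂ (ℕ → Rn n →ₘ[volume] ℂ) where
  carrier := {f | IsMorreySeq p q r f}
  add_mem' hf hg := ⟨fun j => (hf.1 j).add h.one_lt_p (hg.1 j),
    (morreyNorm_lqNorm_add_le h.one_lt_p h.one_lt_q _ _).trans_lt
      (ENNReal.add_lt_top.2 ⟨hf.2, hg.2⟩)⟩
  zero_mem' := ⟨fun _ => isMorrey_zero, by rw [morreyNorm_lqNorm_zero h.one_lt_q]; simp⟩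
  smul_mem' c _ hf := ⟨fun j => (hf.1 j).smul c,
    (morreyNorm_lqNorm_smul_le h.one_lt_q c _).trans_lt (ENNReal.mul_lt_top (by simp) hf.2)⟩

instance (h : MorreyParams n p q r) : Norm (MorreySpace h) :=
  ⟨fun f => (morreyNorm p r (lqNorm q (f : ℕ → Rn n →ₘ[volume] ℂ))).toReal⟩

lemma MorreySpace.norm_def {h : MorreyParams n p q r} (f : MorreySpace h) :
    ‖f‖ = (morreyNorm p r (lqNorm q (f : ℕ → Rn n →ₘ[volume] ℂ))).toReal := rfl

/-- Homogeneity from the corresponding inequality. -/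
lemma norm_smul_of_le {X : Type*} [AddCommGroup X] [Module ℂ X] {N : X → ℝ} (h0 : N 0 = 0)
    (h : ∀ (c : ℂ) (x : X), N (c • x) ≤ ‖c‖ * N x) (c : ℂ) (x : X) : N (c • x) = ‖c‖ * N x := by
  rcases eq_or_ne c 0 with rfl | hc
  · simp [h0]
  refine le_antisymm (h c x) ?_
  have h1 := h c⁻¹ (c • x)
  rw [inv_smul_smul₀ hc, norm_inv] at h1
  have hc' : 0 < ‖c‖ := norm_pos_iff.2 hc
  calc ‖c‖ * N x ≤ ‖c‖ * (‖c‖⁻¹ * N (c • x)) := by gcongr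
    _ = _ := by field_simp

lemma MorreySpace.core (h : MorreyParams n p q r) : NormedSpace.Core ℂ (MorreySpace h) where
  norm_nonneg _ := ENNReal.toReal_nonneg
  norm_smul := by
    refine norm_smul_of_le (by simp [MorreySpace.norm_def, morreyNorm_lqNorm_zero h.one_lt_q]) ?_
    intro c x
    have := ENNReal.toReal_mono (ENNReal.mul_lt_top (by simp) x.2.2).ne
      (morreyNorm_lqNorm_smul_le h.one_lt_q c (x : ℕ → Rn n →ₘ[volume] ℂ))
    simpa [MorreySpace.norm_def] using this
  norm_triangle x y := by
    have := ENNReal.toReal_mono (ENNReal.add_lt_top.2 ⟨x.2.2, y.2.2⟩).ne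
      (morreyNorm_lqNorm_add_le h.one_lt_p h.one_lt_q
        (x : ℕ → Rn n →ₘ[volume] ℂ) (y : ℕ → Rn n →ₘ[volume] ℂ))
    rwa [ENNReal.toReal_add x.2.2.ne y.2.2.ne] at this
  norm_eq_zero_iff x := by
    constructor
    · intro hx
      rw [MorreySpace.norm_def, ENNReal.toReal_eq_zero_iff, or_iff_left x.2.2.ne] at hx
      exact Subtype.ext (eq_zero_of_lqNorm_ae h.one_lt_q
        (ae_eq_zero_of_morreyNorm h.one_lt_p (aemeasurable_lqNorm q _) hx))
    · rintro rfl
      simp [MorreySpace.norm_def, morreyNorm_lqNorm_zero h.one_lt_q]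

instance (h : MorreyParams n p q r) : NormedAddCommGroup (MorreySpace h) :=
  NormedAddCommGroup.ofCore (MorreySpace.core h)

instance (h : MorreyParams n p q r) : NormedSpace ℂ (MorreySpace h) :=
  NormedSpace.ofCore (MorreySpace.core h)

end

/-! ### The norm of `H^ρ L_p` through nonnegative majorants -/

section
variable {n : ℕ} {p q ρ u : ℝ}

/-- An auxiliary expression for the norm of `H^ρ L_p`: the infimum of
`∑ 2^{J(n/p+ρ)} ‖h_{J,M} | L_p‖` over all majorants `∑ h_{J,M}` of `G` with `h_{J,M} ≥ 0` supported
in `Q_{J,M}`. -/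
def domNorm (p ρ : ℝ) (G : Rn n → ℝ≥0∞) : ℝ≥0∞ :=
  ⨅ (h : Idx n → Rn n → ℝ≥0∞) (_ : (∀ i, AEMeasurable (h i)) ∧
    (∀ i, ∀ᵐ x, x ∉ cube i → h i x = 0) ∧ ∀ᵐ x, G x ≤ ∑' i, h i x),
    ∑' i, scale i.1 (n / p + ρ) * eLpNorm (h i) (ENNReal.ofReal p) volume

lemma domNorm_mono {F G : Rn n → ℝ≥0∞} (h : ∀ᵐ x, F x ≤ G x) :
    domNorm p ρ F ≤ domNorm p ρ G := by
  refine le_iInf₂ fun k hk => iInf₂_le_of_le k ⟨hk.1, hk.2.1, ?_⟩ le_rfl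
  filter_upwards [h, hk.2.2] with x h1 h2 using h1.trans h2

lemma domNorm_add_le (hp : 1 < p) (F G : Rn n → ℝ≥0∞) :
    domNorm p ρ (F + G) ≤ domNorm p ρ F + domNorm p ρ G := by
  conv_rhs => unfold domNorm
  simp only [iInf_subtype', ENNReal.iInf_add, ENNReal.add_iInf]
  refine le_iInf fun k => le_iInf fun l => ?_
  obtain ⟨k, hk1, hk2, hk3⟩ := k
  obtain ⟨l, hl1, hl2, hl3⟩ := l
  refine iInf₂_le_of_le (fun i => l i + k i) ⟨fun i => (hl1 i).add (hk1 i), fun i => ?_, ?_⟩ ?_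
  · filter_upwards [hk2 i, hl2 i] with x h1 h2 hx
    simp [h1 hx, h2 hx]
  · filter_upwards [hk3, hl3] with x h1 h2
    simp only [Pi.add_apply, ENNReal.tsum_add]
    exact add_le_add h2 h1
  · rw [← ENNReal.tsum_add]
    refine ENNReal.tsum_le_tsum fun i => ?_
    rw [← mul_add]
    gcongr
    exact eLpNorm_add_le (hl1 i).aestronglyMeasurable (hk1 i).aestronglyMeasurable
      (by simpa using hp.le)

lemma domNorm_zero : domNorm p ρ (fun _ : Rn n => 0) = 0 := by
  refine le_antisymm (iInf₂_le_of_le (fun _ _ => 0) ⟨fun _ => aemeasurable_const, by simp, by simp⟩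
    ?_) zero_le
  simp [show (fun _ : Rn n => (0 : ℝ≥0∞)) = 0 from rfl]

lemma eLpNorm_const_mul_le (c : ℂ) (F : Rn n → ℝ≥0∞) (s : ℝ≥0∞) (μ : Measure (Rn n)) :
    eLpNorm (fun x => ‖c‖ₑ * F x) s μ ≤ ‖c‖ₑ * eLpNorm F s μ := by
  have := eLpNorm_le_nnreal_smul_eLpNorm_of_ae_le_mul' (μ := μ)
    (f := fun x => ‖c‖ₑ * F x) (g := F) (c := ‖c‖₊) (by simp [enorm_eq_nnnorm]) s
  simpa [ENNReal.smul_def, smul_eq_mul, enorm_eq_nnnorm] using this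

lemma domNorm_const_mul_le (c : ℂ) (F : Rn n → ℝ≥0∞) :
    domNorm p ρ (fun x => ‖c‖ₑ * F x) ≤ ‖c‖ₑ * domNorm p ρ F := by
  rcases eq_or_ne c 0 with rfl | hc
  · simp [domNorm_zero]
  conv_rhs => unfold domNorm
  simp only [iInf_subtype']
  rw [ENNReal.mul_iInf_of_ne (by simpa using hc) (by simp)]
  refine le_iInf fun ⟨k, hk1, hk2, hk3⟩ => ?_
  refine iInf₂_le_of_le (fun i x => ‖c‖ₑ * k i x)
    ⟨fun i => (hk1 i).const_mul _, fun i => ?_, ?_⟩ ?_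
  · filter_upwards [hk2 i] with x h1 hx
    simp [h1 hx]
  · filter_upwards [hk3] with x h1
    rw [ENNReal.tsum_mul_left]
    gcongr
  · rw [← ENNReal.tsum_mul_left]
    refine ENNReal.tsum_le_tsum fun i => ?_
    rw [mul_left_comm]
    gcongr
    exact eLpNorm_const_mul_le c _ _ _

lemma eLpNorm_ofReal {s : ℝ} (hs : 0 < s) (F : Rn n → ℝ≥0∞) (μ : Measure (Rn n)) :
    eLpNorm F (ENNReal.ofReal s) μ = (∫⁻ x, F x ^ s ∂μ) ^ (1 / s) := by
  rw [eLpNorm_eq_lintegral_rpow_enorm_toReal (by simpa using hs) (by simp)]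
  simp [ENNReal.toReal_ofReal hs.le]

/-- The norm on test functions against which `H^ρ L_p` is paired. -/
def testNorm (u : ℝ) (φ : Rn n → ℝ≥0∞) : ℝ≥0∞ :=
  eLpNorm φ (ENNReal.ofReal u) volume +
    ENNReal.ofReal ((2 : ℝ) ^ ((n : ℝ) / u)) * eLpNorm φ ∞ volume

lemma eLpNorm_cube_le (hP : PredualParams n p q ρ) (hu : p.HolderConjugate u) (i : Idx n)
    {φ : Rn n → ℝ≥0∞} (hφ : AEMeasurable φ) :
    eLpNorm φ (ENNReal.ofReal u) (volume.restrict (cube i)) ≤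
      scale i.1 (n / p + ρ) * testNorm u φ := by
  have hu0 : 0 < u := hu.symm.pos
  have hp0 : 0 < p := hu.pos
  have hsum : (n : ℝ) / p + n / u = n := by
    have := hu.inv_add_inv_eq_one
    rw [div_eq_mul_inv, div_eq_mul_inv, ← mul_add, this, mul_one]
  rcases le_or_gt i.1 0 with hJ | hJ
  · have h1 : 1 ≤ scale i.1 (n / p + ρ) := by
      unfold scale
      rw [ENNReal.one_le_ofReal]
      refine Real.one_le_rpow (by norm_num) ?_
      have : (i.1 : ℝ) ≤ 0 := by exact_mod_cast hJ
      have := hP.ρ_lt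
      nlinarith
    calc _ ≤ eLpNorm φ (ENNReal.ofReal u) volume := eLpNorm_restrict_le _ _ _ _
      _ ≤ testNorm u φ := le_self_add
      _ ≤ _ := le_mul_of_one_le_left' h1
  · have h1 := eLpNorm_le_eLpNorm_mul_rpow_measure_univ (μ := volume.restrict (cube i))
      (p := ENNReal.ofReal u) (q := ∞) le_top hφ.restrict.aestronglyMeasurable
    have h2 : volume (cube i) ^ (1 / u) ≤
        scale i.1 (n / p + ρ) * ENNReal.ofReal ((2 : ℝ) ^ ((n : ℝ) / u)) := by
      rw [volume_cube, scale, ← ENNReal.ofReal_mul (by positivity),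
        ENNReal.ofReal_rpow_of_pos (by positivity), ← Real.rpow_mul (by norm_num),
        ← Real.rpow_add (by norm_num)]
      refine ENNReal.ofReal_le_ofReal (Real.rpow_le_rpow_of_exponent_le (by norm_num) ?_)
      have h3 : (0 : ℝ) < i.1 := by exact_mod_cast hJ
      have h4 : 0 < (n : ℝ) + ρ := by linarith [hP.lt_ρ]
      have h5 : (n : ℝ) / p = n - n / u := by linarith
      rw [h5, show (1 - (i.1 : ℝ)) * n * (1 / u) = (1 - (i.1 : ℝ)) * (n / u) by ring]
      nlinarith [mul_pos h3 h4]
    simp only [Measure.restrict_apply_univ, ENNReal.toReal_ofReal hu0.le, ENNReal.toReal_top,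
      div_zero, sub_zero] at h1
    calc _ ≤ _ := h1
      _ ≤ eLpNorm φ ∞ volume *
          (scale i.1 (n / p + ρ) * ENNReal.ofReal ((2 : ℝ) ^ ((n : ℝ) / u))) :=
        mul_le_mul' (eLpNorm_restrict_le _ _ _ _) h2
      _ = scale i.1 (n / p + ρ) * (ENNReal.ofReal ((2 : ℝ) ^ ((n : ℝ) / u)) *
          eLpNorm φ ∞ volume) := by ring
      _ ≤ _ := by
        gcongr
        exact le_add_self

lemma lintegral_mul_le_of_cube (hP : PredualParams n p q ρ) (hu : p.HolderConjugate u) (i : Idx n)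
    {k φ : Rn n → ℝ≥0∞} (hk : AEMeasurable k) (hsupp : ∀ᵐ x, x ∉ cube i → k x = 0)
    (hφ : AEMeasurable φ) :
    ∫⁻ x, k x * φ x ≤ testNorm u φ *
      (scale i.1 (n / p + ρ) * eLpNorm k (ENNReal.ofReal p) volume) := by
  have h1 : ∫⁻ x, k x * φ x = ∫⁻ x in cube i, k x * φ x := by
    rw [← lintegral_indicator (measurableSet_cube i)]
    refine lintegral_congr_ae ?_
    filter_upwards [hsupp] with x hx
    by_cases hxi : x ∈ cube i
    · simp [hxi]
    · simp [hxi, hx hxi]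
  have h2 := ENNReal.lintegral_mul_le_Lp_mul_Lq (volume.restrict (cube i)) hu hk.restrict
    hφ.restrict
  rw [← eLpNorm_ofReal hu.pos, ← eLpNorm_ofReal hu.symm.pos] at h2
  rw [h1]
  calc _ ≤ _ := h2
    _ ≤ eLpNorm k (ENNReal.ofReal p) volume * (scale i.1 (n / p + ρ) * testNorm u φ) :=
      mul_le_mul' (eLpNorm_restrict_le _ _ _ _) (eLpNorm_cube_le hP hu i hφ)
    _ = _ := by ring

lemma lintegral_tsum_mul_le (hP : PredualParams n p q ρ) (hu : p.HolderConjugate u)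
    {k : Idx n → Rn n → ℝ≥0∞} {φ : Rn n → ℝ≥0∞} (hk : ∀ i, AEMeasurable (k i))
    (hsupp : ∀ i, ∀ᵐ x, x ∉ cube i → k i x = 0) (hφ : AEMeasurable φ) :
    ∑' i, ∫⁻ x, k i x * φ x ≤ testNorm u φ *
      ∑' i, scale i.1 (n / p + ρ) * eLpNorm (k i) (ENNReal.ofReal p) volume := by
  rw [← ENNReal.tsum_mul_left]
  exact ENNReal.tsum_le_tsum fun i => lintegral_mul_le_of_cube hP hu i (hk i) (hsupp i) hφ

lemma lintegral_mul_le_domNorm (hP : PredualParams n p q ρ) (hu : p.HolderConjugate u)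
    {G φ : Rn n → ℝ≥0∞} (hφ : AEMeasurable φ) (ht : testNorm u φ ≠ ∞) :
    ∫⁻ x, G x * φ x ≤ (testNorm u φ + 1) * domNorm p ρ G := by
  unfold domNorm
  simp only [iInf_subtype']
  rw [ENNReal.mul_iInf_of_ne (by simp) (ENNReal.add_ne_top.2 ⟨ht, ENNReal.one_ne_top⟩)]
  refine le_iInf fun ⟨k, hk1, hk2, hk3⟩ => ?_
  refine le_trans ?_ ((lintegral_tsum_mul_le hP hu hk1 hk2 hφ).trans
    (mul_le_mul_left le_self_add _))
  change _ ≤ ∑' i, ∫⁻ x, k i x * φ x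
  rw [← lintegral_tsum (f := fun i x => k i x * φ x) fun i => (hk1 i).mul hφ]
  refine lintegral_mono_ae ?_
  filter_upwards [hk3] with x hx
  rw [ENNReal.tsum_mul_right]
  gcongr

lemma testNorm_schwartz_ne_top (u : ℝ) (φ : 𝓢(Rn n, ℂ)) : testNorm u (fun x => ‖φ x‖ₑ) ≠ ∞ := by
  have h1 : eLpNorm (fun x => ‖φ x‖ₑ) (ENNReal.ofReal u) volume ≠ ∞ := by
    rw [eLpNorm_enorm]
    exact (φ.memLp (ENNReal.ofReal u) volume).eLpNorm_ne_top
  have h2 : eLpNorm (fun x => ‖φ x‖ₑ) ∞ volume ≠ ∞ := by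
    rw [eLpNorm_enorm]
    exact (φ.memLp ∞ volume).eLpNorm_ne_top
  exact ENNReal.add_ne_top.2 ⟨h1, ENNReal.mul_ne_top ENNReal.ofReal_ne_top h2⟩

end

section
variable {n : ℕ} {p q ρ u : ℝ}

lemma holderConjugate_of (hP : PredualParams n p q ρ) :
    p.HolderConjugate (Real.conjExponent p) :=
  Real.HolderConjugate.conjExponent hP.one_lt_p

lemma testNorm_indicator_ne_top (u R : ℝ) :
    testNorm u ((Metric.closedBall (0 : Rn n) R).indicator fun _ => (1 : ℝ≥0∞)) ≠ ∞ := by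
  have h : ∀ s : ℝ≥0∞, eLpNorm ((Metric.closedBall (0 : Rn n) R).indicator fun _ => (1 : ℝ≥0∞)) s
      volume ≠ ∞ := by
    intro s
    refine ne_of_lt (lt_of_le_of_lt (eLpNorm_indicator_const_le _ _) ?_)
    refine ENNReal.mul_lt_top (by simp) ?_
    exact ENNReal.rpow_lt_top_of_nonneg (by positivity) measure_closedBall_lt_top.ne
  exact ENNReal.add_ne_top.2 ⟨h _, ENNReal.mul_ne_top ENNReal.ofReal_ne_top (h _)⟩

lemma lintegral_closedBall_le (hP : PredualParams n p q ρ) (R : ℝ) :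
    ∃ C : ℝ≥0∞, C ≠ ∞ ∧ ∀ G : Rn n → ℝ≥0∞,
      ∫⁻ x in Metric.closedBall 0 R, G x ≤ C * domNorm p ρ G := by
  refine ⟨_, ENNReal.add_ne_top.2 ⟨testNorm_indicator_ne_top (n := n) (Real.conjExponent p) R,
    ENNReal.one_ne_top⟩, fun G => ?_⟩
  refine le_trans (le_of_eq ?_) (lintegral_mul_le_domNorm hP (holderConjugate_of hP) (G := G)
    (aemeasurable_const.indicator Metric.isClosed_closedBall.measurableSet)
    (testNorm_indicator_ne_top _ R))
  rw [← lintegral_indicator Metric.isClosed_closedBall.measurableSet]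
  congr 1
  funext x
  by_cases hx : x ∈ Metric.closedBall (0 : Rn n) R <;> simp [Set.indicator, hx]

lemma domNorm_tsum_le {k : Idx n → Rn n → ℝ≥0∞} (hk : ∀ i, AEMeasurable (k i))
    (hsupp : ∀ i, ∀ᵐ x, x ∉ cube i → k i x = 0) :
    domNorm p ρ (fun x => ∑' i, k i x) ≤
      ∑' i, scale i.1 (n / p + ρ) * eLpNorm (k i) (ENNReal.ofReal p) volume :=
  iInf₂_le_of_le k ⟨hk, hsupp, by simp⟩ le_rfl

lemma ae_lt_top_of_domNorm (hP : PredualParams n p q ρ) {G : Rn n → ℝ≥0∞} (hG : AEMeasurable G)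
    (h : domNorm p ρ G < ∞) : ∀ᵐ x, G x < ∞ := by
  have h1 : ∀ m : ℕ, ∀ᵐ x, x ∈ Metric.closedBall (0 : Rn n) m → G x < ∞ := by
    intro m
    rw [← ae_restrict_iff' Metric.isClosed_closedBall.measurableSet]
    obtain ⟨C, hC, hCG⟩ := lintegral_closedBall_le hP (m : ℝ)
    exact ae_lt_top' hG.restrict
      ((hCG G).trans_lt (ENNReal.mul_lt_top hC.lt_top h)).ne
  filter_upwards [ae_all_iff.2 h1] with x hx
  obtain ⟨m, hm⟩ := exists_nat_ge ‖x‖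
  exact hx m (by simpa using hm)

lemma ae_eq_zero_of_domNorm (hP : PredualParams n p q ρ) {G : Rn n → ℝ≥0∞} (hG : AEMeasurable G)
    (h : domNorm p ρ G = 0) : ∀ᵐ x, G x = 0 := by
  have h1 : ∀ m : ℕ, ∀ᵐ x, x ∈ Metric.closedBall (0 : Rn n) m → G x = 0 := by
    intro m
    rw [← ae_restrict_iff' Metric.isClosed_closedBall.measurableSet]
    obtain ⟨C, hC, hCG⟩ := lintegral_closedBall_le hP (m : ℝ)
    have h2 := hCG G
    rw [h, mul_zero, nonpos_iff_eq_zero, lintegral_eq_zero_iff' hG.restrict] at h2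
    exact h2
  filter_upwards [ae_all_iff.2 h1] with x hx
  obtain ⟨m, hm⟩ := exists_nat_ge ‖x‖
  exact hx m (by simpa using hm)

lemma locallyIntegrable_of_domNorm (hP : PredualParams n p q ρ) {F : Rn n → ℂ}
    (hF : AEStronglyMeasurable F volume) (h : domNorm p ρ (fun x => ‖F x‖ₑ) < ∞) :
    LocallyIntegrable F volume := by
  intro x
  obtain ⟨C, hC, hCG⟩ := lintegral_closedBall_le hP (‖x‖ + 1)
  refine ⟨Metric.closedBall 0 (‖x‖ + 1), Metric.closedBall_mem_nhds_of_mem (by simp), hF.restrict,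
    (hCG _).trans_lt (ENNReal.mul_lt_top hC.lt_top h)⟩

lemma IsRegular.locallyIntegrable {h : 𝓢'(Rn n, ℂ)} {F : Rn n → ℂ} (hF : IsRegular h F) :
    LocallyIntegrable F volume := by
  intro x
  let f : ContDiffBump x := default
  have h1 : HasCompactSupport (Complex.ofRealCLM ∘ f) := f.hasCompactSupport.comp_left rfl
  have h2 : ContDiff ℝ (⊤ : ℕ∞) (Complex.ofRealCLM ∘ f) := Complex.ofRealCLM.contDiff.comp f.contDiff
  refine ⟨Metric.closedBall x f.rIn, Metric.closedBall_mem_nhds _ f.rIn_pos, ?_⟩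
  refine ((hF.integrable (h1.toSchwartzMap h2)).integrableOn).congr_fun (fun y hy => ?_)
    Metric.isClosed_closedBall.measurableSet
  simp [f.one_of_mem_closedBall hy]

lemma exists_lintegral_mul_le (hP : PredualParams n p q ρ) (hu : p.HolderConjugate u)
    {G : Rn n → ℝ≥0∞} (h : domNorm p ρ G < ∞) : ∃ C : ℝ≥0∞, C ≠ ∞ ∧ ∀ φ : Rn n → ℝ≥0∞,
      AEMeasurable φ → ∫⁻ x, G x * φ x ≤ testNorm u φ * C := by
  obtain ⟨k, hk⟩ := iInf_lt_iff.1 h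
  obtain ⟨⟨hk1, hk2, hk3⟩, hk⟩ := iInf_lt_iff.1 hk
  refine ⟨_, hk.ne, fun φ hφ => ?_⟩
  refine le_trans ?_ (lintegral_tsum_mul_le hP hu hk1 hk2 hφ)
  rw [← lintegral_tsum (f := fun i x => k i x * φ x) fun i => (hk1 i).mul hφ]
  refine lintegral_mono_ae ?_
  filter_upwards [hk3] with x hx
  rw [ENNReal.tsum_mul_right]
  gcongr

/-- Regular distributions from functions with finite `domNorm`. -/
lemma exists_isRegular (hP : PredualParams n p q ρ) {F : Rn n → ℂ}
    (hF : AEStronglyMeasurable F volume) (h : domNorm p ρ (fun x => ‖F x‖ₑ) < ∞) :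
    ∃ T : 𝓢'(Rn n, ℂ), IsRegular T F := by
  set u := Real.conjExponent p with hu
  have hpu : p.HolderConjugate u := holderConjugate_of hP
  have hu1 : 1 < u := hpu.symm.lt
  have : Fact (1 ≤ ENNReal.ofReal u) := ⟨by simpa using hu1.le⟩
  obtain ⟨C, hC, hCF⟩ := exists_lintegral_mul_le hP hpu h
  have hbound : ∀ φ : 𝓢(Rn n, ℂ), ∫⁻ x, ‖φ x * F x‖ₑ ≤ testNorm u (fun x => ‖φ x‖ₑ) * C := by
    intro φ
    refine le_trans (le_of_eq ?_) (hCF _ φ.continuous.aestronglyMeasurable.enorm)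
    simp [enorm_mul, mul_comm]
  have hint : ∀ φ : 𝓢(Rn n, ℂ), Integrable fun x => φ x * F x := fun φ =>
    ⟨φ.continuous.aestronglyMeasurable.mul hF, (hbound φ).trans_lt (ENNReal.mul_lt_top
      (testNorm_schwartz_ne_top u φ).lt_top hC.lt_top)⟩
  let L : 𝓢(Rn n, ℂ) →ₗ[ℂ] ℂ :=
    { toFun := fun φ => ∫ x, φ x * F x
      map_add' := fun φ ψ => by
        rw [← integral_add (hint φ) (hint ψ)]
        simp [add_mul]
      map_smul' := fun c φ => by
        simp only [smul_apply, smul_eq_mul, RingHom.id_apply, mul_assoc]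
        rw [integral_const_mul] }
  have hL : ∀ φ : 𝓢(Rn n, ℂ), ‖L φ‖ ≤ (‖toLpCLM ℂ ℂ (ENNReal.ofReal u) volume φ‖ +
      (2 : ℝ) ^ ((n : ℝ) / u) * ‖toLpCLM ℂ ℂ ∞ volume φ‖) * C.toReal := by
    intro φ
    have h1 : ‖L φ‖ₑ ≤ testNorm u (fun x => ‖φ x‖ₑ) * C :=
      (enorm_integral_le_lintegral_enorm _).trans (hbound φ)
    have h2 := ENNReal.toReal_mono
      (ENNReal.mul_lt_top (testNorm_schwartz_ne_top u φ).lt_top hC.lt_top).ne h1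
    rw [toReal_enorm, ENNReal.toReal_mul] at h2
    refine h2.trans (le_of_eq ?_)
    congr 1
    have e1 : eLpNorm (fun x => ‖φ x‖ₑ) (ENNReal.ofReal u) volume ≠ ∞ := by
      rw [eLpNorm_enorm]
      exact (φ.memLp (ENNReal.ofReal u) volume).eLpNorm_ne_top
    have e2 : eLpNorm (fun x => ‖φ x‖ₑ) ∞ volume ≠ ∞ := by
      rw [eLpNorm_enorm]
      exact (φ.memLp ∞ volume).eLpNorm_ne_top
    rw [testNorm, ENNReal.toReal_add e1 (ENNReal.mul_ne_top ENNReal.ofReal_ne_top e2),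
      ENNReal.toReal_mul, ENNReal.toReal_ofReal (by positivity), eLpNorm_enorm, eLpNorm_enorm]
    have e3 : ‖toLpCLM ℂ ℂ (ENNReal.ofReal u) volume φ‖ =
        (eLpNorm φ (ENNReal.ofReal u) volume).toReal :=
      Lp.norm_toLp φ (φ.memLp (ENNReal.ofReal u) volume)
    have e4 : ‖toLpCLM ℂ ℂ ∞ volume φ‖ = (eLpNorm φ ∞ volume).toReal :=
      Lp.norm_toLp φ (φ.memLp ∞ volume)
    rw [e3, e4]
  have hcont : Continuous L := by
    refine continuous_of_continuousAt_zero L ?_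
    rw [ContinuousAt, map_zero]
    refine squeeze_zero_norm hL ?_
    have : Continuous fun φ : 𝓢(Rn n, ℂ) => (‖toLpCLM ℂ ℂ (ENNReal.ofReal u) volume φ‖ +
      (2 : ℝ) ^ ((n : ℝ) / u) * ‖toLpCLM ℂ ℂ ∞ volume φ‖) * C.toReal := by fun_prop
    have h0 := this.tendsto 0
    simp only [map_zero, norm_zero, mul_zero, add_zero, zero_mul] at h0
    exact h0
  exact ⟨ContinuousLinearMap.toPointwiseConvergenceCLM _ _ _ _ (⟨L, hcont⟩ : 𝓢(Rn n, ℂ) →L[ℂ] ℂ),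
    hF, hint, fun φ => rfl⟩

/-- A nonnegative majorant gives an atomic representation. -/
lemma predualNorm_le_domNorm (hP : PredualParams n p q ρ) {F : Rn n → ℂ}
    (hF : AEStronglyMeasurable F volume) :
    predualNorm p ρ F ≤ domNorm p ρ (fun x => ‖F x‖ₑ) := by
  refine le_iInf₂ fun k hk => ?_
  obtain ⟨hk1, hk2, hk3⟩ := hk
  set w : Idx n → ℝ≥0∞ := fun i => scale i.1 (n / p + ρ) with hw
  set N : Idx n → ℝ≥0∞ := fun i => eLpNorm (k i) (ENNReal.ofReal p) volume with hN
  change _ ≤ ∑' i, w i * N i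
  rcases eq_or_ne (∑' i, w i * N i) ∞ with htop | htop
  · rw [htop]; exact le_top
  have hp0 : 0 < p := by linarith [hP.one_lt_p]
  have hw0 : ∀ i, w i ≠ 0 := fun i => scale_ne_zero _ _
  have hwt : ∀ i, w i ≠ ∞ := fun i => scale_ne_top _ _
  have hwN : ∀ i, w i * N i ≠ ∞ := fun i => ENNReal.ne_top_of_tsum_ne_top htop i
  have hNt : ∀ i, N i ≠ ∞ := fun i h => hwN i (by rw [h, ENNReal.mul_top (hw0 i)])
  set S : Rn n → ℝ≥0∞ := fun x => ∑' i, k i x with hS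
  have hSm : AEMeasurable S := AEMeasurable.tsum hk1
  have hSt : ∀ᵐ x, S x < ∞ :=
    ae_lt_top_of_domNorm hP hSm ((domNorm_tsum_le hk1 hk2).trans_lt htop.lt_top)
  have hdom : domNorm p ρ (fun x => ‖F x‖ₑ) < ∞ :=
    (iInf₂_le_of_le k ⟨hk1, hk2, hk3⟩ le_rfl).trans_lt htop.lt_top
  obtain ⟨T, hT⟩ := exists_isRegular hP hF hdom
  -- the pieces
  set b : Idx n → Rn n → ℂ := fun i x => F x * ((k i x / S x).toReal : ℂ) with hb
  have hbm : ∀ i, AEStronglyMeasurable (b i) volume := fun i => hF.mul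
    (Complex.measurable_ofReal.comp_aemeasurable
      ((hk1 i).div hSm).ennreal_toReal).aestronglyMeasurable
  have hbk : ∀ᵐ x, ∀ i, ‖b i x‖ₑ ≤ k i x := by
    filter_upwards [hk3] with x hx i
    calc ‖b i x‖ₑ = ‖F x‖ₑ * ENNReal.ofReal (k i x / S x).toReal := by
          rw [hb, enorm_mul, ← ofReal_norm ((_ : ℝ) : ℂ)]
          simp
      _ ≤ S x * (k i x / S x) := mul_le_mul' hx ENNReal.ofReal_toReal_le
      _ ≤ k i x := ENNReal.mul_div_le
  have hbsum : ∀ᵐ x, HasSum (fun i => b i x) (F x) := by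
    filter_upwards [hk3, hSt] with x hx hxt
    rcases eq_or_ne (S x) 0 with h0 | h0
    · have hF0 : F x = 0 := by
        have : ‖F x‖ₑ ≤ S x := hx
        rw [h0] at this
        simpa using this
      simp [hb, hF0, hasSum_zero]
    · have e1 : ∑' i, k i x / S x = 1 := by
        simp only [div_eq_mul_inv]
        rw [ENNReal.tsum_mul_right]
        exact ENNReal.mul_inv_cancel h0 hxt.ne
      have e0 : ∑' i, k i x / S x ≠ ∞ := by rw [e1]; simp
      have e2 := ENNReal.hasSum_toReal e0
      rw [← ENNReal.tsum_toReal_eq (ENNReal.ne_top_of_tsum_ne_top e0), e1, ENNReal.toReal_one]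
        at e2
      have e3 := (Complex.hasSum_ofReal.2 e2).mul_left (F x)
      rw [Complex.ofReal_one, mul_one] at e3
      exact e3
  have hbN : ∀ i, eLpNorm (b i) (ENNReal.ofReal p) volume ≤ N i := fun i =>
    eLpNorm_mono_enorm_ae (by filter_upwards [hbk] with x hx using by simpa using hx i)
  set c : Idx n → ℂ := fun i => ((w i * N i).toReal : ℂ) with hc
  have hce : ∀ i, ‖c i‖ₑ = w i * N i := fun i => by
    rw [hc, ← ofReal_norm]
    simp only [Complex.norm_real, Real.norm_eq_abs, abs_of_nonneg ENNReal.toReal_nonneg]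
    exact ENNReal.ofReal_toReal (hwN i)
  have hcb : ∀ i, ∀ᵐ x, c i * ((c i)⁻¹ * b i x) = b i x := by
    intro i
    rcases eq_or_ne (c i) 0 with h0 | h0
    · have h1 : w i * N i = 0 := by rw [← hce, h0]; simp
      have h2 : N i = 0 := (mul_eq_zero.1 h1).resolve_left (hw0 i)
      rw [hN, eLpNorm_eq_zero_iff (hk1 i).aestronglyMeasurable (by simpa using hp0)] at h2
      filter_upwards [h2, hbk] with x hx hx'
      have h3 := hx' i
      rw [hx] at h3
      have h4 : b i x = 0 := by simpa using h3
      simp [h4]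
    · exact Filter.Eventually.of_forall fun x => mul_inv_cancel_left₀ h0 _
  have hrep : IsAtomicRep p ρ T c fun i x => (c i)⁻¹ * b i x := by
    refine ⟨fun i => ?_, fun i => ?_, fun i => ?_, ?_, fun φ => ?_⟩
    · exact MemLp.const_mul ⟨hbm i, (hbN i).trans_lt (hNt i).lt_top⟩ _
    · filter_upwards [hk2 i, hbk] with x h1 h2 hx
      have h3 := h2 i
      rw [h1 hx] at h3
      have h4 : b i x = 0 := by simpa using h3
      simp [h4]
    · have h1 : eLpNorm (fun x => (c i)⁻¹ * b i x) (ENNReal.ofReal p) volume =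
          ‖(c i)⁻¹‖ₑ * eLpNorm (b i) (ENNReal.ofReal p) volume :=
        eLpNorm_const_smul (c i)⁻¹ (b i) _ _
      rw [h1]
      rcases eq_or_ne (c i) 0 with h0 | h0
      · simp [h0]
      · have h2 : w i * N i ≠ 0 := by
          rw [← hce]
          simpa using h0
        have h3 : N i ≠ 0 := right_ne_zero_of_mul h2
        rw [enorm_inv h0, hce]
        calc (w i * N i)⁻¹ * eLpNorm (b i) (ENNReal.ofReal p) volume
            ≤ (w i * N i)⁻¹ * N i := by gcongr; exact hbN i
          _ = (w i * N i)⁻¹ * N i * (w i * scale i.1 (-(n / p + ρ))) := by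
              rw [hw, scale_mul_scale_neg, mul_one]
          _ = ((w i * N i)⁻¹ * (w i * N i)) * scale i.1 (-(n / p + ρ)) := by ring
          _ = scale i.1 (-(n / p + ρ)) := by rw [ENNReal.inv_mul_cancel h2 (hwN i), one_mul]
          _ ≤ _ := le_rfl
    · have h1 : (fun i => ‖c i‖) = fun i => (w i * N i).toReal := by
        funext i
        rw [← hce, toReal_enorm]
      rw [h1]
      exact ENNReal.summable_toReal htop
    · have e1 : ∀ i, c i * ∫ x, φ x * ((c i)⁻¹ * b i x) = ∫ x, φ x * b i x := by
        intro i
        rw [← integral_const_mul]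
        refine integral_congr_ae ?_
        filter_upwards [hcb i] with x hx
        rw [mul_left_comm, hx]
      simp only [e1]
      have hle : ∑' i, ∫⁻ x, ‖φ x * b i x‖ₑ ≤ testNorm (Real.conjExponent p) (fun x => ‖φ x‖ₑ) *
          ∑' i, w i * N i := by
        refine le_trans (ENNReal.tsum_le_tsum fun i => lintegral_mono_ae ?_)
          (lintegral_tsum_mul_le hP (holderConjugate_of hP) hk1 hk2
            φ.continuous.aestronglyMeasurable.enorm)
        filter_upwards [hbk] with x hx
        rw [enorm_mul, mul_comm]
        gcongr
        exact hx i
      have hfin : ∑' i, ∫⁻ x, ‖φ x * b i x‖ₑ ≠ ∞ :=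
        (hle.trans_lt (ENNReal.mul_lt_top (testNorm_schwartz_ne_top _ φ).lt_top htop.lt_top)).ne
      have hint : ∀ i, Integrable fun x => φ x * b i x := fun i =>
        ⟨φ.continuous.aestronglyMeasurable.mul (hbm i),
          (ENNReal.ne_top_of_tsum_ne_top hfin i).lt_top⟩
      have hs := hasSum_integral_of_summable_integral_norm hint (by
        simp only [integral_norm_eq_lintegral_enorm (hint _).1]
        exact ENNReal.summable_toReal hfin)
      rw [hT.apply_eq]
      have e2 : ∫ x, φ x * F x = ∫ x, ∑' i, φ x * b i x := by
        refine integral_congr_ae ?_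
        filter_upwards [hbsum] with x hx
        exact (hx.mul_left (φ x)).tsum_eq.symm
      rw [e2]
      exact hs
  calc predualNorm p ρ F ≤ predualNormDist p ρ T := iInf₂_le T hT
    _ ≤ ∑' i, ‖c i‖ₑ := iInf_le_of_le c (iInf₂_le _ hrep)
    _ = _ := by simp only [hce]

/-- A function in `H^ρ L_p` is dominated by the atoms of each of its representations. -/
lemma domNorm_le_predualNorm (hP : PredualParams n p q ρ) (F : Rn n → ℂ) :
    domNorm p ρ (fun x => ‖F x‖ₑ) ≤ predualNorm p ρ F := by
  refine le_iInf₂ fun T hT => le_iInf fun c => le_iInf₂ fun a hrep => ?_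
  set k : Idx n → Rn n → ℝ≥0∞ := fun i x => ‖c i‖ₑ * ‖a i x‖ₑ with hk
  have hk1 : ∀ i, AEMeasurable (k i) := fun i => (hrep.memLp i).1.enorm.const_mul _
  have hk2 : ∀ i, ∀ᵐ x, x ∉ cube i → k i x = 0 := fun i => by
    filter_upwards [hrep.supp i] with x h1 hx
    simp [hk, h1 hx]
  have hle : ∑' i, scale i.1 (n / p + ρ) * eLpNorm (k i) (ENNReal.ofReal p) volume ≤
      ∑' i, ‖c i‖ₑ := by
    refine ENNReal.tsum_le_tsum fun i => ?_
    calc _ ≤ scale i.1 (n / p + ρ) * (‖c i‖ₑ * scale i.1 (-(n / p + ρ))) := by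
          gcongr
          refine (eLpNorm_const_mul_le _ _ _ _).trans ?_
          gcongr
          rw [eLpNorm_enorm]
          exact hrep.norm_le i
      _ = ‖c i‖ₑ := by rw [mul_left_comm, scale_mul_scale_neg, mul_one]
  have hct : ∑' i, ‖c i‖ₑ ≠ ∞ := by
    have h1 : Summable fun i => ‖c i‖₊ := by
      rw [← NNReal.summable_coe]
      exact hrep.summable
    exact ENNReal.tsum_coe_ne_top_iff_summable.2 h1
  have htop : domNorm p ρ (fun x => ∑' i, k i x) < ∞ :=
    ((domNorm_tsum_le hk1 hk2).trans hle).trans_lt hct.lt_top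
  have hSt : ∀ᵐ x, ∑' i, k i x < ∞ := ae_lt_top_of_domNorm hP (AEMeasurable.tsum hk1) htop
  set G : Rn n → ℂ := fun x => ∑' i, c i * a i x with hG
  have hGle : ∀ᵐ x, ‖G x‖ₑ ≤ ∑' i, k i x := by
    filter_upwards with x
    refine (enorm_tsum_le_tsum_enorm (f := fun i => c i * a i x)).trans (le_of_eq ?_)
    simp [hk, enorm_mul]
  have hGm : AEStronglyMeasurable G volume := by
    refine AEMeasurable.aestronglyMeasurable ?_
    exact AEMeasurable.tsum fun i => ((hrep.memLp i).1.const_mul (c i)).aemeasurable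
  have hFG : ∀ᵐ x, F x = G x := by
    refine ae_eq_of_integral_contDiff_smul_eq hT.locallyIntegrable
      (locallyIntegrable_of_domNorm hP hGm ((domNorm_mono hGle).trans_lt htop)) fun g hg hgc => ?_
    have h1 : HasCompactSupport (Complex.ofRealCLM ∘ g) := hgc.comp_left rfl
    have h2 : ContDiff ℝ (⊤ : ℕ∞) (Complex.ofRealCLM ∘ g) := Complex.ofRealCLM.contDiff.comp hg
    set φ : 𝓢(Rn n, ℂ) := h1.toSchwartzMap h2 with hφ
    have hφg : ∀ x, φ x = (g x : ℂ) := fun x => rfl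
    have hle' : ∑' i, ∫⁻ x, ‖φ x * (c i * a i x)‖ₑ ≤
        testNorm (Real.conjExponent p) (fun x => ‖φ x‖ₑ) * ∑' i, ‖c i‖ₑ := by
      refine le_trans (ENNReal.tsum_le_tsum fun i => le_of_eq ?_)
        ((lintegral_tsum_mul_le hP (holderConjugate_of hP) hk1 hk2
          φ.continuous.aestronglyMeasurable.enorm).trans (mul_le_mul_right hle _))
      simp only [hk, enorm_mul, mul_comm]
    have hfin : ∑' i, ∫⁻ x, ‖φ x * (c i * a i x)‖ₑ ≠ ∞ :=
      (hle'.trans_lt (ENNReal.mul_lt_top (testNorm_schwartz_ne_top _ φ).lt_top hct.lt_top)).ne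
    have hint : ∀ i, Integrable fun x => φ x * (c i * a i x) := fun i =>
      ⟨φ.continuous.aestronglyMeasurable.mul ((hrep.memLp i).1.const_mul (c i)),
        (ENNReal.ne_top_of_tsum_ne_top hfin i).lt_top⟩
    have hs := hasSum_integral_of_summable_integral_norm hint (by
      simp only [integral_norm_eq_lintegral_enorm (hint _).1]
      exact ENNReal.summable_toReal hfin)
    have hs' := hrep.hasSum φ
    have e1 : (fun i => c i * ∫ x, φ x * a i x) = fun i => ∫ x, φ x * (c i * a i x) := by
      funext i
      rw [← integral_const_mul]
      simp only [mul_left_comm]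
    rw [e1] at hs'
    have e2 := hs'.unique hs
    rw [hT.apply_eq] at e2
    simp only [Complex.real_smul, ← hφg]
    rw [e2]
    simp only [tsum_mul_left, hG]
  refine le_trans (domNorm_mono ?_) ((domNorm_tsum_le hk1 hk2).trans hle)
  filter_upwards [hFG, hGle] with x h1 h2
  rwa [h1]

lemma predualNorm_eq (hP : PredualParams n p q ρ) {F : Rn n → ℂ}
    (hF : AEStronglyMeasurable F volume) :
    predualNorm p ρ F = domNorm p ρ (fun x => ‖F x‖ₑ) :=
  le_antisymm (predualNorm_le_domNorm hP hF) (domNorm_le_predualNorm hP F)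

end

/-! ### The predual Morrey space as a normed space -/

section
variable {n : ℕ} {p q ρ : ℝ}

lemma predualSeqNorm_eq (hP : PredualParams n p q ρ) {f : ℕ → Rn n →ₘ[volume] ℂ}
    (hf : ∀ᵐ x, lqNorm q f x < ∞) :
    predualSeqNorm p q ρ f = domNorm p ρ (lqNorm q f) := by
  have h : ∀ᵐ x, ‖((lqNorm q f x).toReal : ℂ)‖ₑ = lqNorm q f x := by
    filter_upwards [hf] with x hx
    rw [← ofReal_norm]
    simp only [Complex.norm_real, Real.norm_eq_abs, abs_of_nonneg ENNReal.toReal_nonneg]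
    exact ENNReal.ofReal_toReal hx.ne
  rw [predualSeqNorm, predualNorm_eq hP (F := fun x => ((lqNorm q f x).toReal : ℂ)) (Complex.measurable_ofReal.comp_aemeasurable
    (aemeasurable_lqNorm q f).ennreal_toReal).aestronglyMeasurable]
  exact le_antisymm (domNorm_mono (by filter_upwards [h] with x hx using hx.le))
    (domNorm_mono (by filter_upwards [h] with x hx using hx.ge))

lemma isPredualSeq_iff (hP : PredualParams n p q ρ) (f : ℕ → Rn n →ₘ[volume] ℂ) :
    IsPredualSeq p q ρ f ↔ domNorm p ρ (lqNorm q f) < ∞ := by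
  constructor
  · rintro ⟨-, h1, h2⟩
    rwa [← predualSeqNorm_eq hP h1]
  · intro h
    have h1 := ae_lt_top_of_domNorm hP (aemeasurable_lqNorm q f) h
    refine ⟨fun j => ?_, h1, ?_⟩
    · rw [predualNorm_eq hP (f j).aestronglyMeasurable]
      exact (domNorm_mono (Filter.Eventually.of_forall
        fun x => enorm_le_lqNorm hP.one_lt_q f j x)).trans_lt h
    · rwa [predualSeqNorm_eq hP h1]

lemma domNorm_lqNorm_add_le (hP : PredualParams n p q ρ) (f g : ℕ → Rn n →ₘ[volume] ℂ) :
    domNorm p ρ (lqNorm q (f + g)) ≤ domNorm p ρ (lqNorm q f) + domNorm p ρ (lqNorm q g) :=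
  (domNorm_mono (lqNorm_add_le hP.one_lt_q f g)).trans (domNorm_add_le hP.one_lt_p _ _)

lemma domNorm_lqNorm_smul_le (hP : PredualParams n p q ρ) (c : ℂ)
    (f : ℕ → Rn n →ₘ[volume] ℂ) :
    domNorm p ρ (lqNorm q (c • f)) ≤ ‖c‖ₑ * domNorm p ρ (lqNorm q f) :=
  (domNorm_mono (by filter_upwards [lqNorm_smul hP.one_lt_q c f] with x hx using hx.le)).trans
    (domNorm_const_mul_le c _)

lemma domNorm_lqNorm_zero (hP : PredualParams n p q ρ) :
    domNorm p ρ (lqNorm q (0 : ℕ → Rn n →ₘ[volume] ℂ)) = 0 := by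
  refine le_antisymm ?_ zero_le
  rw [← domNorm_zero (n := n) (p := p) (ρ := ρ)]
  exact domNorm_mono (by filter_upwards [lqNorm_zero hP.one_lt_q] with x hx using hx.le)

/-- The space `H^ρ L_p(ℓ_q, ℝⁿ)`. -/
def PredualSpace (h : PredualParams n p q ρ) : Submodule ℂ (ℕ → Rn n →ₘ[volume] ℂ) where
  carrier := {f | IsPredualSeq p q ρ f}
  add_mem' {f g} hf hg := by
    have hf' := (isPredualSeq_iff h f).1 hf
    have hg' := (isPredualSeq_iff h g).1 hg
    exact (isPredualSeq_iff h _).2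
      ((domNorm_lqNorm_add_le h f g).trans_lt (ENNReal.add_lt_top.2 ⟨hf', hg'⟩))
  zero_mem' := (isPredualSeq_iff h _).2 (by rw [domNorm_lqNorm_zero h]; simp)
  smul_mem' c f hf := by
    have hf' := (isPredualSeq_iff h f).1 hf
    exact (isPredualSeq_iff h _).2
      ((domNorm_lqNorm_smul_le h c f).trans_lt (ENNReal.mul_lt_top (by simp) hf'))

instance (h : PredualParams n p q ρ) : Norm (PredualSpace h) :=
  ⟨fun f => (predualSeqNorm p q ρ (f : ℕ → Rn n →ₘ[volume] ℂ)).toReal⟩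

lemma PredualSpace.norm_def {h : PredualParams n p q ρ} (f : PredualSpace h) :
    ‖f‖ = (predualSeqNorm p q ρ (f : ℕ → Rn n →ₘ[volume] ℂ)).toReal := rfl

lemma PredualSpace.domNorm_lt_top {h : PredualParams n p q ρ} (f : PredualSpace h) :
    domNorm p ρ (lqNorm q (f : ℕ → Rn n →ₘ[volume] ℂ)) < ∞ := (isPredualSeq_iff h _).1 f.2

lemma PredualSpace.norm_eq {h : PredualParams n p q ρ} (f : PredualSpace h) :
    ‖f‖ = (domNorm p ρ (lqNorm q (f : ℕ → Rn n →ₘ[volume] ℂ))).toReal := by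
  rw [PredualSpace.norm_def, predualSeqNorm_eq h f.2.2.1]

lemma PredualSpace.core (h : PredualParams n p q ρ) : NormedSpace.Core ℂ (PredualSpace h) where
  norm_nonneg _ := ENNReal.toReal_nonneg
  norm_smul := by
    refine norm_smul_of_le (by simp [PredualSpace.norm_eq, domNorm_lqNorm_zero h]) ?_
    intro c x
    have := ENNReal.toReal_mono (ENNReal.mul_lt_top (by simp) (PredualSpace.domNorm_lt_top x)).ne
      (domNorm_lqNorm_smul_le h c (x : ℕ → Rn n →ₘ[volume] ℂ))
    simpa [PredualSpace.norm_eq] using this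
  norm_triangle x y := by
    have := ENNReal.toReal_mono (ENNReal.add_lt_top.2 ⟨(PredualSpace.domNorm_lt_top x), (PredualSpace.domNorm_lt_top y)⟩).ne
      (domNorm_lqNorm_add_le h (x : ℕ → Rn n →ₘ[volume] ℂ) (y : ℕ → Rn n →ₘ[volume] ℂ))
    rw [ENNReal.toReal_add (PredualSpace.domNorm_lt_top x).ne (PredualSpace.domNorm_lt_top y).ne] at this
    simpa [PredualSpace.norm_eq] using this
  norm_eq_zero_iff x := by
    constructor
    · intro hx
      rw [PredualSpace.norm_eq, ENNReal.toReal_eq_zero_iff, or_iff_left (PredualSpace.domNorm_lt_top x).ne] at hx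
      exact Subtype.ext (eq_zero_of_lqNorm_ae h.one_lt_q
        (ae_eq_zero_of_domNorm h (aemeasurable_lqNorm q _) hx))
    · rintro rfl
      simp [PredualSpace.norm_eq, domNorm_lqNorm_zero h]

instance (h : PredualParams n p q ρ) : NormedAddCommGroup (PredualSpace h) :=
  NormedAddCommGroup.ofCore (PredualSpace.core h)

instance (h : PredualParams n p q ρ) : NormedSpace ℂ (PredualSpace h) :=
  NormedSpace.ofCore (PredualSpace.core h)

end

/-! ### The duality pairing and the parameters -/

/-- The pairing `∫ ∑_j g_j(x) f_j(x) dx`. -/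
def pairing {n : ℕ} (g f : ℕ → Rn n →ₘ[volume] ℂ) : ℂ := ∫ x, ∑' j, g j x * f j x

lemma MorreyParams.of_lt {n : ℕ} {p q r : ℝ} (hp : 1 < p) (hq : 1 < q) (hr : -(n / p) < r)
    (hr0 : r < 0) : MorreyParams n p q r := ⟨hp, hq, hr.le, hr0⟩

lemma PredualParams.of_conj {n : ℕ} {p p' q q' r ρ : ℝ} (hp : p.HolderConjugate p')
    (hq : q.HolderConjugate q') (hr : -(n / p) < r) (hr0 : r < 0) (hρ : r + ρ = -n) :
    PredualParams n p' q' ρ := by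
  refine ⟨hp.symm.lt, hq.symm.lt, by linarith, ?_⟩
  have h1 : (n : ℝ) / p + n / p' = n := by
    rw [div_eq_mul_inv, div_eq_mul_inv, ← mul_add, hp.inv_add_inv_eq_one, mul_one]
  linarith

end MorreyDual

end

open MorreyDual MeasureTheory

/-!
Both norms reduce to norms of the nonnegative function `‖f_j(·) | ℓ_q‖`: the Morrey norm
`morreyNorm`, and for the predual the infimum `domNorm` of `∑ 2^{J(n/p'+ρ)} ‖k_{J,M} | L_{p'}‖` over
all majorants `∑ k_{J,M}` with `k_{J,M} ≥ 0` supported in `Q_{J,M}`. Since `r + ρ = -n`, the factors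
`2^{J(n/p+r)}` and `2^{J(n/p'+ρ)}` are inverse to each other, and Hölder's inequality on each cube
gives `∫ G F ≤ morreyNorm G * domNorm F` (`lintegral_mul_le_morreyNorm_mul_domNorm`). So the pairing
converges absolutely and defines functionals of norm at most `‖g‖`.

The majorant norm is countably subadditive (`domNorm_tsum_le_tsum`), which yields completeness
through absolutely convergent series, and it is order continuous
(`tendsto_domNorm_of_dominated`): a function dominated by `F` is distributed over the cubes in the
proportions of a majorant of `F`, and dominated convergence is applied on each cube and to the sum.
Order continuity has two consequences. Truncation shows that test sequences (finitely many nonzero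
members, all bounded with bounded support) are dense, so that a functional is determined by its
values on them and, a fortiori, on a weighted space. And for a bounded functional `T` and a strictly
positive `w` in the predual, `s ↦ T(1_s w e_j)` is a complex measure, absolutely continuous with
respect to Lebesgue measure; its Radon–Nikodym density divided by `w` is the `j`-th member of a
sequence `g` that represents `T` on test sequences (`exists_eq_pairing`).

That the norm of the functional is not smaller than the Morrey norm of `g`, and in particular that
the `g` so obtained is a Morrey sequence, is the converse of Hölder's inequality
(`morreyNorm_le_of_pairing_le`): on a fixed cube, `g` is truncated and tested against
`f_j = conj(g_j) |g_j|^{q-2} ‖g‖_{ℓ_q}^{p-q}`, a test sequence, and the truncation is then removed by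
monotone convergence.

The embedding of the weighted space with `α > n/p` follows by cutting a function along dyadic shells
(`exists_domNorm_le_weightedNorm`); the norms of the pieces are bounded by a
geometric series, which converges as soon as `α > n/p + r = -(n/p' + ρ)`.
-/

open MorreyDual MeasureTheory

noncomputable section

namespace MorreyDual

open Filter Topology
open scoped ENNReal ComplexConjugate

/-! ### The majorant norm -/

section
variable {n : ℕ} {p p' q q' r ρ α : ℝ}

lemma domNorm_congr {F G : Rn n → ℝ≥0∞} (h : ∀ᵐ x, F x = G x) :
    domNorm p ρ F = domNorm p ρ G :=
  le_antisymm (domNorm_mono (h.mono fun _ hx => hx.le)) (domNorm_mono (h.mono fun _ hx => hx.ge))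

lemma domNorm_le {F : Rn n → ℝ≥0∞} {k : Idx n → Rn n → ℝ≥0∞} (hk : ∀ i, AEMeasurable (k i))
    (hsupp : ∀ i, ∀ᵐ x, x ∉ cube i → k i x = 0) (hF : ∀ᵐ x, F x ≤ ∑' i, k i x) :
    domNorm p ρ F ≤ ∑' i, scale i.1 (n / p + ρ) * eLpNorm (k i) (ENNReal.ofReal p) volume :=
  iInf₂_le_of_le k ⟨hk, hsupp, hF⟩ le_rfl

/-- Minkowski's inequality for countable sums of nonnegative functions. -/
lemma lintegral_rpow_tsum_le {X : Type*} [MeasurableSpace X] {μ : Measure X} (hp : 1 < p)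
    {k : ℕ → X → ℝ≥0∞} (hk : ∀ m, AEMeasurable (k m) μ) :
    (∫⁻ x, (∑' m, k m x) ^ p ∂μ) ^ (1 / p) ≤ ∑' m, (∫⁻ x, k m x ^ p ∂μ) ^ (1 / p) := by
  have hp0 : 0 < p := by linarith
  have h1 : Tendsto (fun N => ∫⁻ x, (∑ m ∈ Finset.range N, k m x) ^ p ∂μ) atTop
      (𝓝 (∫⁻ x, (∑' m, k m x) ^ p ∂μ)) := by
    refine lintegral_tendsto_of_tendsto_of_monotone
      (fun N => (Finset.aemeasurable_fun_sum _ fun m _ => hk m).pow_const _)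
      (Eventually.of_forall fun x => ?_) (Eventually.of_forall fun x => ?_)
    · intro N M hNM
      refine ENNReal.rpow_le_rpow ?_ hp0.le
      exact Finset.sum_le_sum_of_subset (Finset.range_mono hNM)
    · exact ((ENNReal.continuous_rpow_const (y := p)).tendsto _).comp
        ENNReal.summable.hasSum.tendsto_sum_nat
  refine le_of_tendsto' (((ENNReal.continuous_rpow_const (y := 1 / p)).tendsto _).comp h1)
    fun N => le_trans ?_ (ENNReal.sum_le_tsum (Finset.range N))
  have h2 : ∀ F : X → ℝ≥0∞, eLpNorm F (ENNReal.ofReal p) μ = (∫⁻ x, F x ^ p ∂μ) ^ (1 / p) := by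
    intro F
    rw [eLpNorm_eq_lintegral_rpow_enorm_toReal (by simpa using hp0) (by simp)]
    simp [ENNReal.toReal_ofReal hp0.le]
  have h3 := eLpNorm_sum_le (s := Finset.range N) (f := k) (p := ENNReal.ofReal p) (μ := μ)
    (fun m _ => (hk m).aestronglyMeasurable) (by simpa using hp.le)
  simp only [h2, Finset.sum_apply] at h3
  exact h3

lemma eLpNorm_tsum_le_tsum (hp : 1 < p) {k : ℕ → Rn n → ℝ≥0∞} (hk : ∀ m, AEMeasurable (k m)) :
    eLpNorm (fun x => ∑' m, k m x) (ENNReal.ofReal p) volume ≤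
      ∑' m, eLpNorm (k m) (ENNReal.ofReal p) volume := by
  simp only [eLpNorm_ofReal (zero_lt_one.trans hp)]
  exact lintegral_rpow_tsum_le hp hk

/-- Countable subadditivity of the majorant norm. -/
lemma domNorm_tsum_le_tsum (hp : 1 < p) (G : ℕ → Rn n → ℝ≥0∞) :
    domNorm p ρ (fun x => ∑' m, G m x) ≤ ∑' m, domNorm p ρ (G m) := by
  refine ENNReal.le_of_forall_pos_le_add fun ε hε hfin => ?_
  obtain ⟨δ, hδ, hδε⟩ := ENNReal.exists_pos_sum_of_countable' (ε := (ε : ℝ≥0∞))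
    (by simpa using hε.ne') ℕ
  have h1 : ∀ m, ∃ k : Idx n → Rn n → ℝ≥0∞, ((∀ i, AEMeasurable (k i)) ∧
      (∀ i, ∀ᵐ x, x ∉ cube i → k i x = 0) ∧ ∀ᵐ x, G m x ≤ ∑' i, k i x) ∧
      ∑' i, scale i.1 (n / p + ρ) * eLpNorm (k i) (ENNReal.ofReal p) volume ≤
        domNorm p ρ (G m) + δ m := by
    intro m
    have h2 : domNorm p ρ (G m) < domNorm p ρ (G m) + δ m :=
      ENNReal.lt_add_right (ENNReal.ne_top_of_tsum_ne_top hfin.ne m) (hδ m).ne'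
    obtain ⟨k, hk⟩ := iInf_lt_iff.1 h2
    obtain ⟨hk1, hk2⟩ := iInf_lt_iff.1 hk
    exact ⟨k, hk1, hk2.le⟩
  choose k hk hle using h1
  refine (domNorm_le (k := fun i x => ∑' m, k m i x)
    (fun i => AEMeasurable.tsum fun m => (hk m).1 i) (fun i => ?_) ?_).trans ?_
  · filter_upwards [ae_all_iff.2 fun m => (hk m).2.1 i] with x hx hxi
    simp [fun m => hx m hxi]
  · filter_upwards [ae_all_iff.2 fun m => (hk m).2.2] with x hx
    rw [ENNReal.tsum_comm]
    exact ENNReal.tsum_le_tsum hx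
  · calc _ ≤ ∑' i : Idx n, ∑' m, scale i.1 (n / p + ρ) *
          eLpNorm (k m i) (ENNReal.ofReal p) volume := by
          refine ENNReal.tsum_le_tsum fun i => ?_
          rw [ENNReal.tsum_mul_left]
          gcongr
          exact eLpNorm_tsum_le_tsum hp fun m => (hk m).1 i
      _ = ∑' m, ∑' i : Idx n, scale i.1 (n / p + ρ) *
          eLpNorm (k m i) (ENNReal.ofReal p) volume := ENNReal.tsum_comm
      _ ≤ ∑' m, (domNorm p ρ (G m) + δ m) := ENNReal.tsum_le_tsum hle
      _ ≤ _ := by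
          rw [ENNReal.tsum_add]
          gcongr

/-- The majorant norm is order continuous: it satisfies dominated convergence. -/
lemma tendsto_domNorm_of_dominated (hP : PredualParams n p q ρ) {G : ℕ → Rn n → ℝ≥0∞}
    {F : Rn n → ℝ≥0∞} (hG : ∀ m, AEMeasurable (G m)) (hF : domNorm p ρ F < ∞)
    (hle : ∀ m, ∀ᵐ x, G m x ≤ F x) (hlim : ∀ᵐ x, Tendsto (fun m => G m x) atTop (𝓝 0)) :
    Tendsto (fun m => domNorm p ρ (G m)) atTop (𝓝 0) := by
  have hp0 : 0 < p := by linarith [hP.one_lt_p]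
  obtain ⟨k, hk⟩ := iInf_lt_iff.1 hF
  obtain ⟨⟨hk1, hk2, hk3⟩, hk⟩ := iInf_lt_iff.1 hk
  set S : Rn n → ℝ≥0∞ := fun x => ∑' i, k i x with hS
  have hSm : AEMeasurable S := AEMeasurable.tsum hk1
  have hSt : ∀ᵐ x, S x < ∞ :=
    ae_lt_top_of_domNorm hP hSm ((domNorm_tsum_le hk1 hk2).trans_lt hk)
  -- `G m` is split along the majorant of `F`, in the proportions `k i / S`
  set b : ℕ → Idx n → Rn n → ℝ≥0∞ := fun m i x => G m x * (k i x / S x) with hb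
  have hbm : ∀ m i, AEMeasurable (b m i) := fun m i => (hG m).mul ((hk1 i).div hSm)
  have hbk : ∀ m, ∀ᵐ x, ∀ i, b m i x ≤ k i x := by
    intro m
    filter_upwards [hle m, hk3] with x h1 h2 i
    exact (mul_le_mul_left (h1.trans h2) _).trans ENNReal.mul_div_le
  have hbsum : ∀ m, ∀ᵐ x, G m x ≤ ∑' i, b m i x := by
    intro m
    filter_upwards [hle m, hk3, hSt] with x h1 h2 h3
    simp only [hb, ENNReal.tsum_mul_left, div_eq_mul_inv, ENNReal.tsum_mul_right]
    change _ ≤ G m x * (S x * (S x)⁻¹)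
    rcases eq_or_ne (S x) 0 with h0 | h0
    · have : G m x ≤ S x := h1.trans h2
      rw [h0] at this
      rw [nonpos_iff_eq_zero.1 this]
      exact zero_le
    · rw [ENNReal.mul_inv_cancel h0 h3.ne, mul_one]
  have hfin : ∀ i, eLpNorm (k i) (ENNReal.ofReal p) volume ≠ ∞ := fun i h =>
    ENNReal.ne_top_of_tsum_ne_top hk.ne i (by rw [h, ENNReal.mul_top (scale_ne_zero _ _)])
  have hblim : ∀ i : Idx n, Tendsto (fun m => scale i.1 (n / p + ρ) *
      eLpNorm (b m i) (ENNReal.ofReal p) volume) atTop (𝓝 0) := by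
    intro i
    have h1 : Tendsto (fun m => ∫⁻ x, b m i x ^ p) atTop (𝓝 (∫⁻ _ : Rn n, 0)) := by
      refine tendsto_lintegral_of_dominated_convergence' (fun x => k i x ^ p)
        (fun m => (hbm m i).pow_const _) (fun m => ?_) ?_ ?_
      · filter_upwards [hbk m] with x hx
        exact ENNReal.rpow_le_rpow (hx i) hp0.le
      · have := hfin i
        rw [eLpNorm_ofReal hp0] at this
        intro h
        rw [h] at this
        simp [hp0] at this
      · filter_upwards [hlim, hk3, hSt] with x h1 h2 h3
        have h4 : k i x / S x ≠ ∞ := by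
          have : k i x / S x ≤ 1 := ENNReal.div_le_of_le_mul (by
            rw [one_mul]; exact ENNReal.le_tsum (f := fun i => k i x) i)
          exact (this.trans_lt ENNReal.one_lt_top).ne
        have h5 := ENNReal.Tendsto.mul_const h1 (Or.inr h4)
        rw [zero_mul] at h5
        have h6 := (ENNReal.continuous_rpow_const (y := p)).tendsto 0 |>.comp h5
        rwa [ENNReal.zero_rpow_of_pos hp0] at h6
    rw [lintegral_zero] at h1
    have h2 := (ENNReal.continuous_rpow_const (y := 1 / p)).tendsto 0 |>.comp h1
    rw [ENNReal.zero_rpow_of_pos (by positivity)] at h2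
    have h3 := ENNReal.Tendsto.const_mul h2 (Or.inr (scale_ne_top i.1 (n / p + ρ)))
    rw [mul_zero] at h3
    refine h3.congr fun m => ?_
    simp only [Function.comp_apply, eLpNorm_ofReal hp0]
  have hsum : Tendsto (fun m => ∑' i : Idx n, scale i.1 (n / p + ρ) *
      eLpNorm (b m i) (ENNReal.ofReal p) volume) atTop (𝓝 0) := by
    have h1 := tendsto_lintegral_of_dominated_convergence (μ := Measure.count (α := Idx n))
      (F := fun m i => scale i.1 (n / p + ρ) * eLpNorm (b m i) (ENNReal.ofReal p) volume)
      (f := fun _ => 0)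
      (fun i => scale i.1 (n / p + ρ) * eLpNorm (k i) (ENNReal.ofReal p) volume)
      (fun m => measurable_of_countable _) (fun m => Eventually.of_forall fun i => ?_) ?_
      (Eventually.of_forall hblim)
    · simpa only [lintegral_count, tsum_zero] using h1
    · refine mul_le_mul_right (eLpNorm_mono_enorm_ae ?_) _
      filter_upwards [hbk m] with x hx
      simpa using hx i
    · rw [lintegral_count]
      exact hk.ne
  refine tendsto_of_tendsto_of_tendsto_of_le_of_le tendsto_const_nhds hsum
    (fun _ => zero_le) fun m => domNorm_le (hbm m) (fun i => ?_) (hbsum m)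
  filter_upwards [hk2 i] with x hx hxi
  simp [hb, hx hxi]

/-- A function supported in a single cube is its own majorant. -/
lemma domNorm_le_of_cube (i : Idx n) {F : Rn n → ℝ≥0∞} (hF : AEMeasurable F)
    (hsupp : ∀ᵐ x, x ∉ cube i → F x = 0) :
    domNorm p ρ F ≤ scale i.1 (n / p + ρ) * eLpNorm F (ENNReal.ofReal p) volume := by
  classical
  refine (domNorm_le (k := Pi.single i F) (fun l => ?_) (fun l => ?_) ?_).trans ?_
  · rcases eq_or_ne l i with rfl | h
    · simpa using hF
    · rw [Pi.single_eq_of_ne h]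
      exact measurable_zero.aemeasurable
  · rcases eq_or_ne l i with rfl | h
    · simpa using hsupp
    · simp [Pi.single_eq_of_ne h]
  · refine Eventually.of_forall fun x => ?_
    have := ENNReal.le_tsum (f := fun l => (Pi.single i F : Idx n → Rn n → ℝ≥0∞) l x) i
    simpa using this
  · rw [tsum_eq_single i]
    · simp
    · intro l hl
      simp [Pi.single_eq_of_ne hl]

/-- Hölder's inequality for the Morrey norm and the majorant norm. -/
lemma lintegral_mul_le_morreyNorm_mul_domNorm (hp : p.HolderConjugate p') (hρ : r + ρ = -n)
    {G F : Rn n → ℝ≥0∞} (hG : AEMeasurable G) (hGt : morreyNorm p r G ≠ ∞) :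
    ∫⁻ x, G x * F x ≤ morreyNorm p r G * domNorm p' ρ F := by
  rcases eq_or_ne (morreyNorm p r G) 0 with h0 | h0
  · have h1 := ae_eq_zero_of_morreyNorm hp.lt hG h0
    rw [h0, zero_mul, nonpos_iff_eq_zero]
    refine (lintegral_congr_ae ?_).trans lintegral_zero
    filter_upwards [h1] with x hx
    simp [hx]
  unfold domNorm
  simp only [iInf_subtype']
  rw [ENNReal.mul_iInf_of_ne h0 hGt]
  refine le_iInf fun ⟨k, hk1, hk2, hk3⟩ => ?_
  have hexp : (n : ℝ) / p' + ρ = -(n / p + r) := by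
    have h1 : (n : ℝ) / p + n / p' = n := by
      rw [div_eq_mul_inv, div_eq_mul_inv, ← mul_add, hp.inv_add_inv_eq_one, mul_one]
    linarith
  calc ∫⁻ x, G x * F x ≤ ∫⁻ x, ∑' i, G x * k i x := by
        refine lintegral_mono_ae ?_
        filter_upwards [hk3] with x hx
        rw [ENNReal.tsum_mul_left]
        gcongr
    _ = ∑' i, ∫⁻ x, G x * k i x := lintegral_tsum fun i => hG.mul (hk1 i)
    _ ≤ ∑' i : Idx n, morreyNorm p r G *
        (scale i.1 (n / p' + ρ) * eLpNorm (k i) (ENNReal.ofReal p') volume) := by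
        refine ENNReal.tsum_le_tsum fun i => ?_
        have h1 : ∫⁻ x, G x * k i x = ∫⁻ x in cube i, G x * k i x := by
          rw [← lintegral_indicator (measurableSet_cube i)]
          refine lintegral_congr_ae ?_
          filter_upwards [hk2 i] with x hx
          by_cases hxi : x ∈ cube i
          · simp [hxi]
          · simp [hxi, hx hxi]
        have h2 := ENNReal.lintegral_mul_le_Lp_mul_Lq (volume.restrict (cube i)) hp
          hG.restrict (hk1 i).restrict
        rw [← eLpNorm_ofReal hp.pos, ← eLpNorm_ofReal hp.symm.pos] at h2
        have h3 : scale i.1 (n / p + r) *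
            eLpNorm G (ENNReal.ofReal p) (volume.restrict (cube i)) ≤ morreyNorm p r G :=
          le_iSup (fun i : Idx n => scale i.1 (n / p + r) *
            eLpNorm G (ENNReal.ofReal p) (volume.restrict (cube i))) i
        rw [h1]
        calc _ ≤ _ := h2
          _ ≤ eLpNorm G (ENNReal.ofReal p) (volume.restrict (cube i)) *
              eLpNorm (k i) (ENNReal.ofReal p') volume :=
            mul_le_mul_right (eLpNorm_restrict_le _ _ _ _) _
          _ = (scale i.1 (n / p + r) * scale i.1 (-(n / p + r))) *
              (eLpNorm G (ENNReal.ofReal p) (volume.restrict (cube i)) *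
              eLpNorm (k i) (ENNReal.ofReal p') volume) := by
            rw [scale_mul_scale_neg, one_mul]
          _ = (scale i.1 (n / p + r) *
              eLpNorm G (ENNReal.ofReal p) (volume.restrict (cube i))) *
              (scale i.1 (-(n / p + r)) * eLpNorm (k i) (ENNReal.ofReal p') volume) := by ring
          _ ≤ _ := by
            rw [hexp]
            gcongr
    _ = _ := ENNReal.tsum_mul_left

/-- The weighted space embeds into the space with the majorant norm: a function is cut along the
dyadic shells `2^m [-1,1]^n \ 2^(m-1) [-1,1]^n`, on which the weight is at least `2^((m-1)α)`. -/
lemma exists_domNorm_le_weightedNorm (hP : PredualParams n p q ρ) (hα : -(n / p + ρ) < α) :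
    ∃ C : NNReal, ∀ F : Rn n → ℝ≥0∞, AEMeasurable F →
      domNorm p ρ F ≤ C * weightedNorm p α F := by
  have hp0 : 0 < p := by linarith [hP.one_lt_p]
  have hs : 0 < -((n : ℝ) / p + ρ) := by linarith [hP.ρ_lt]
  have hα0 : 0 < α := hs.trans hα
  set s : ℝ := -((n : ℝ) / p + ρ) with hsdef
  set t : ℝ := (2 : ℝ) ^ (s - α) with ht
  have ht0 : 0 ≤ t := by positivity
  have ht1 : t < 1 := Real.rpow_lt_one_of_one_lt_of_neg (by norm_num) (by linarith)
  have hsummable : Summable fun m : ℕ => (2 : ℝ) ^ α * t ^ m :=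
    (summable_geometric_of_lt_one ht0 ht1).mul_left _
  -- the bound for the `m`-th shell is the `m`-th term of this geometric series
  refine ⟨Real.toNNReal (∑' m : ℕ, (2 : ℝ) ^ α * t ^ m), fun F hF => ?_⟩
  -- the cubes `2^m [-1,1]^n` and the shells between them
  set Q : ℕ → Set (Rn n) := fun m => cube (-(m : ℤ), 0) with hQ
  have hQm : ∀ m, MeasurableSet (Q m) := fun m => measurableSet_cube _
  have hmem : ∀ m x, x ∈ Q m ↔ ∀ k, |x k| ≤ 2 ^ m := by
    intro m x
    simp [hQ, cube, abs_le]
  set A : ℕ → Set (Rn n) := disjointed Q with hA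
  have hAm : ∀ m, MeasurableSet (A m) := fun m => MeasurableSet.disjointed hQm m
  have hAQ : ∀ m, A m ⊆ Q m := fun m => disjointed_subset Q m
  have hcover : ∀ x, ∃ m, x ∈ A m := by
    intro x
    have h1 : x ∈ ⋃ m, Q m := by
      obtain ⟨m, hm⟩ := pow_unbounded_of_one_lt ‖x‖ (one_lt_two (α := ℝ))
      exact Set.mem_iUnion.2 ⟨m, (hmem m x).2 fun k =>
        (PiLp.norm_apply_le x k).trans hm.le⟩
    rw [← iUnion_disjointed] at h1
    exact Set.mem_iUnion.1 h1
  have hweight : ∀ m x, x ∈ A m →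
      1 ≤ ENNReal.ofReal ((2 : ℝ) ^ α * (2 : ℝ) ^ (-(m * α))) *
        ENNReal.ofReal ((1 + ‖x‖ ^ 2) ^ (α / 2)) := by
    intro m x hx
    rw [← ENNReal.ofReal_mul (by positivity), ENNReal.one_le_ofReal,
      ← Real.rpow_add (by norm_num)]
    rcases m with _ | m
    · have h1 : 1 ≤ (2 : ℝ) ^ (α + -(((0 : ℕ) : ℝ) * α)) :=
        Real.one_le_rpow (by norm_num) (by simp [hα0.le])
      have h2 : 1 ≤ (1 + ‖x‖ ^ 2) ^ (α / 2) :=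
        Real.one_le_rpow (by nlinarith [sq_nonneg ‖x‖]) (by positivity)
      exact one_le_mul_of_one_le_of_one_le h1 h2
    · have h1 : x ∉ Q m := by
        intro h
        rw [hA, disjointed_add_one] at hx
        exact hx.2 (Set.mem_of_mem_of_subset h (le_partialSups Q m))
      rw [hmem] at h1
      push Not at h1
      obtain ⟨k, hk⟩ := h1
      have h2 : (2 : ℝ) ^ m ≤ ‖x‖ :=
        hk.le.trans (PiLp.norm_apply_le x k)
      have h3 : ((2 : ℝ) ^ (m : ℝ)) ^ α ≤ (1 + ‖x‖ ^ 2) ^ (α / 2) := by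
        rw [Real.rpow_natCast]
        calc ((2 : ℝ) ^ m) ^ α ≤ ‖x‖ ^ α := Real.rpow_le_rpow (by positivity) h2 hα0.le
          _ = (‖x‖ ^ 2) ^ (α / 2) := by
            rw [← Real.rpow_natCast, ← Real.rpow_mul (norm_nonneg x)]
            congr 1
            push_cast
            ring
          _ ≤ _ := Real.rpow_le_rpow (by positivity) (by linarith) (by positivity)
      rw [← Real.rpow_mul (by norm_num)] at h3
      have h4 : α + -(((m + 1 : ℕ) : ℝ) * α) = -(m * α) := by push_cast; ring
      rw [h4]
      calc (1 : ℝ) = (2 : ℝ) ^ (-(m * α)) * (2 : ℝ) ^ (m * α) := by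
            rw [← Real.rpow_add (by norm_num)]; simp
        _ ≤ _ := by gcongr
  have hpiece : ∀ m, domNorm p ρ ((A m).indicator F) ≤
      ENNReal.ofReal ((2 : ℝ) ^ α * t ^ m) * weightedNorm p α F := by
    intro m
    refine (domNorm_le_of_cube (-(m : ℤ), 0) (hF.indicator (hAm m))
      (Eventually.of_forall fun x hx => ?_)).trans ?_
    · exact Set.indicator_of_notMem (fun h => hx (hAQ m h)) _
    · have h1 : eLpNorm ((A m).indicator F) (ENNReal.ofReal p) volume ≤
          ENNReal.ofReal ((2 : ℝ) ^ α * (2 : ℝ) ^ (-(m * α))) * weightedNorm p α F := by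
        have := eLpNorm_le_nnreal_smul_eLpNorm_of_ae_le_mul' (μ := volume)
          (f := (A m).indicator F)
          (g := fun x => ENNReal.ofReal ((1 + ‖x‖ ^ 2) ^ (α / 2)) * ‖F x‖ₑ)
          (c := Real.toNNReal ((2 : ℝ) ^ α * (2 : ℝ) ^ (-(m * α))))
          (Eventually.of_forall fun x => ?_) (ENNReal.ofReal p)
        · rwa [ENNReal.smul_def, smul_eq_mul] at this
        · by_cases hx : x ∈ A m
          · simp only [Set.indicator_of_mem hx, enorm_eq_self]
            calc F x = 1 * F x := (one_mul _).symm
              _ ≤ _ := mul_le_mul_left (hweight m x hx) _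
              _ = _ := by rw [mul_assoc]; rfl
          · simp [Set.indicator_of_notMem hx]
      calc _ ≤ scale (-(m : ℤ)) (n / p + ρ) *
            (ENNReal.ofReal ((2 : ℝ) ^ α * (2 : ℝ) ^ (-(m * α))) * weightedNorm p α F) := by
            gcongr
        _ = _ := by
          rw [← mul_assoc, scale, ← ENNReal.ofReal_mul (by positivity)]
          congr 2
          rw [mul_left_comm, ← Real.rpow_add (by norm_num), ht, ← Real.rpow_natCast,
            ← Real.rpow_mul (by norm_num)]
          congr 2
          rw [hsdef]
          push_cast
          ring
  calc domNorm p ρ F ≤ domNorm p ρ (fun x => ∑' m, (A m).indicator F x) := by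
        refine domNorm_mono (Eventually.of_forall fun x => ?_)
        obtain ⟨m, hm⟩ := hcover x
        refine le_trans ?_ (ENNReal.le_tsum m)
        rw [Set.indicator_of_mem hm]
    _ ≤ ∑' m, domNorm p ρ ((A m).indicator F) := domNorm_tsum_le_tsum hP.one_lt_p _
    _ ≤ ∑' m : ℕ, ENNReal.ofReal ((2 : ℝ) ^ α * t ^ m) * weightedNorm p α F :=
        ENNReal.tsum_le_tsum hpiece
    _ = _ := by
        rw [ENNReal.tsum_mul_right, ← ENNReal.ofReal_tsum_of_nonneg (fun m => by positivity)
          hsummable]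
        rfl

end

/-! ### Completeness of the predual -/

section
variable {n : ℕ} {p p' q q' r ρ α : ℝ}

/-- Minkowski's inequality in `ℓ_q` for countable sums of sequences. -/
lemma tsum_rpow_tsum_le (hq : 1 < q) (a : ℕ → ℕ → ℂ) :
    (∑' j, ‖∑' m, a m j‖ₑ ^ q) ^ (1 / q) ≤ ∑' m, (∑' j, ‖a m j‖ₑ ^ q) ^ (1 / q) := by
  have h := lintegral_rpow_tsum_le (μ := Measure.count) hq (k := fun m j => ‖a m j‖ₑ)
    fun m => (measurable_of_countable _).aemeasurable
  simp only [lintegral_count] at h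
  refine le_trans ?_ h
  gcongr with j
  exact enorm_tsum_le_tsum_enorm

lemma PredualSpace.enorm_eq {h : PredualParams n p q ρ} (f : PredualSpace h) :
    ‖f‖ₑ = domNorm p ρ (lqNorm q (f : ℕ → Rn n →ₘ[volume] ℂ)) := by
  rw [← ofReal_norm, PredualSpace.norm_eq, ENNReal.ofReal_toReal (PredualSpace.domNorm_lt_top f).ne]

lemma MorreySpace.enorm_eq {h : MorreyParams n p q r} (g : MorreySpace h) :
    ‖g‖ₑ = morreyNorm p r (lqNorm q (g : ℕ → Rn n →ₘ[volume] ℂ)) := by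
  rw [← ofReal_norm, MorreySpace.norm_def, ENNReal.ofReal_toReal g.2.2.ne]

/-- An absolutely convergent series in the predual converges pointwise almost everywhere, and its
tails are dominated by the tails of the series of `ℓ_q` norms. -/
theorem PredualSpace.completeSpace (h : PredualParams n p q ρ) :
    CompleteSpace (PredualSpace h) := by
  refine NormedAddCommGroup.completeSpace_of_summable_imp_tendsto fun u hu => ?_
  set F : ℕ → Rn n → ℝ≥0∞ := fun m => lqNorm q (u m : ℕ → Rn n →ₘ[volume] ℂ) with hF
  have hFsum : ∑' m, domNorm p ρ (F m) ≠ ∞ := by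
    have h1 := hu.tsum_ofReal_ne_top
    simpa only [ofReal_norm, PredualSpace.enorm_eq] using h1
  have hFm : ∀ m, AEMeasurable (F m) := fun m => aemeasurable_lqNorm q _
  have hS : ∀ᵐ x, ∑' m, F m x < ∞ := ae_lt_top_of_domNorm h (AEMeasurable.tsum hFm)
    ((domNorm_tsum_le_tsum h.one_lt_p F).trans_lt hFsum.lt_top)
  have hmeas : ∀ j, AEStronglyMeasurable
      (fun x => ∑' m, (u m : ℕ → Rn n →ₘ[volume] ℂ) j x) volume := fun j =>
    (AEMeasurable.tsum fun m => ((u m : ℕ → Rn n →ₘ[volume] ℂ) j).aemeasurable).aestronglyMeasurable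
  set f : ℕ → Rn n →ₘ[volume] ℂ := fun j => AEEqFun.mk _ (hmeas j) with hf
  have hfj : ∀ᵐ x, ∀ j, f j x = ∑' m, (u m : ℕ → Rn n →ₘ[volume] ℂ) j x :=
    ae_all_iff.2 fun j => AEEqFun.coeFn_mk _ (hmeas j)
  have hsummable : ∀ᵐ x, ∀ j, Summable fun m => (u m : ℕ → Rn n →ₘ[volume] ℂ) j x := by
    filter_upwards [hS] with x hx j
    refine Summable.of_enorm (ne_top_of_le_ne_top hx.ne ?_)
    exact ENNReal.tsum_le_tsum fun m => enorm_le_lqNorm h.one_lt_q _ j x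
  set s : ℕ → ℕ → Rn n →ₘ[volume] ℂ :=
    fun N => ∑ m ∈ Finset.range N, (u m : ℕ → Rn n →ₘ[volume] ℂ) with hs
  have htail : ∀ N, ∀ᵐ x, ∀ j, (f - s N) j x =
      ∑' m, (u (m + N) : ℕ → Rn n →ₘ[volume] ℂ) j x := by
    intro N
    induction N with
    | zero => simpa [hs] using hfj
    | succ N ih =>
      have h1 : ∀ j, (f - s (N + 1)) j =
          (f - s N) j - (u N : ℕ → Rn n →ₘ[volume] ℂ) j := by
        intro j
        simp only [hs, Finset.sum_range_succ, Pi.sub_apply, Pi.add_apply]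
        abel
      have h2 : ∀ᵐ x, ∀ j, ((f - s N) j - (u N : ℕ → Rn n →ₘ[volume] ℂ) j :
          Rn n →ₘ[volume] ℂ) x = (f - s N) j x - (u N : ℕ → Rn n →ₘ[volume] ℂ) j x :=
        ae_all_iff.2 fun j => AEEqFun.coeFn_sub _ _
      filter_upwards [ih, h2, hsummable] with x hx1 hx2 hx3 j
      have h4 : Summable fun m => (u (m + N) : ℕ → Rn n →ₘ[volume] ℂ) j x :=
        (summable_nat_add_iff N).2 (hx3 j)
      rw [h1, hx2, hx1, h4.tsum_eq_zero_add, zero_add, add_sub_cancel_left]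
      simp only [add_assoc, add_comm 1 N]
  have hle : ∀ N, domNorm p ρ (lqNorm q (f - s N)) ≤ ∑' m, domNorm p ρ (F (m + N)) := by
    intro N
    refine (domNorm_mono ?_).trans (domNorm_tsum_le_tsum h.one_lt_p fun m => F (m + N))
    filter_upwards [htail N] with x hx
    simp only [lqNorm, hx, hF]
    exact tsum_rpow_tsum_le h.one_lt_q fun m j => (u (m + N) : ℕ → Rn n →ₘ[volume] ℂ) j x
  have hfH : f ∈ PredualSpace h := by
    refine (isPredualSeq_iff h f).2 ?_
    have h1 := (hle 0).trans_lt (by simpa using hFsum.lt_top)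
    simpa [hs] using h1
  refine ⟨⟨f, hfH⟩, ?_⟩
  rw [tendsto_iff_edist_tendsto_0]
  refine tendsto_of_tendsto_of_tendsto_of_le_of_le tendsto_const_nhds
    (ENNReal.tendsto_sum_nat_add _ hFsum) (fun _ => zero_le) fun N => ?_
  refine le_trans (le_of_eq ?_) (hle N)
  rw [edist_comm, edist_eq_enorm_sub, PredualSpace.enorm_eq]
  simp [hs]

/-- The weighted space is continuously embedded in the predual. -/
lemma exists_enorm_le_weightedNorm (h : PredualParams n p q ρ) (hα : -(n / p + ρ) < α) :
    ∃ C : NNReal, ∀ f : ℕ → Rn n →ₘ[volume] ℂ, IsWeightedSeq p q α f →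
      ∃ hf : f ∈ PredualSpace h, ‖(⟨f, hf⟩ : PredualSpace h)‖ₑ ≤
        C * weightedNorm p α (lqNorm q f) := by
  obtain ⟨C, hC⟩ := exists_domNorm_le_weightedNorm (α := α) h hα
  refine ⟨C, fun f hf => ?_⟩
  have h1 := hC _ (aemeasurable_lqNorm q f)
  refine ⟨(isPredualSeq_iff h f).2 (h1.trans_lt (ENNReal.mul_lt_top (by simp) hf.2)), ?_⟩
  rw [PredualSpace.enorm_eq]
  exact h1

end

/-! ### The pairing as a bounded bilinear map -/

section
variable {n : ℕ} {p p' q q' r ρ α : ℝ}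

lemma tsum_enorm_mul_le_lqNorm_mul_lqNorm (hq : q.HolderConjugate q')
    (g f : ℕ → Rn n →ₘ[volume] ℂ) (x : Rn n) :
    ∑' j, ‖g j x * f j x‖ₑ ≤ lqNorm q g x * lqNorm q' f x := by
  have h := ENNReal.lintegral_mul_le_Lp_mul_Lq (Measure.count (α := ℕ)) hq
    (f := fun j => ‖g j x‖ₑ) (g := fun j => ‖f j x‖ₑ)
    (measurable_of_countable _).aemeasurable (measurable_of_countable _).aemeasurable
  simpa only [lintegral_count, Pi.mul_apply, enorm_mul, lqNorm] using h

lemma lintegral_tsum_enorm_mul_le (hp : p.HolderConjugate p') (hq : q.HolderConjugate q')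
    (hρ : r + ρ = -n) {g f : ℕ → Rn n →ₘ[volume] ℂ} (hg : morreyNorm p r (lqNorm q g) < ∞) :
    ∫⁻ x, ∑' j, ‖g j x * f j x‖ₑ ≤
      morreyNorm p r (lqNorm q g) * domNorm p' ρ (lqNorm q' f) :=
  (lintegral_mono fun x => tsum_enorm_mul_le_lqNorm_mul_lqNorm hq g f x).trans
    (lintegral_mul_le_morreyNorm_mul_domNorm hp hρ (aemeasurable_lqNorm q g) hg.ne)

lemma aemeasurable_tsum_enorm_mul (g f : ℕ → Rn n →ₘ[volume] ℂ) :
    AEMeasurable fun x => ∑' j, ‖g j x * f j x‖ₑ :=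
  AEMeasurable.tsum fun j => ((g j).aestronglyMeasurable.mul (f j).aestronglyMeasurable).enorm

lemma ae_summable_mul {g f : ℕ → Rn n →ₘ[volume] ℂ} (h : ∫⁻ x, ∑' j, ‖g j x * f j x‖ₑ < ∞) :
    ∀ᵐ x, Summable fun j => g j x * f j x := by
  filter_upwards [ae_lt_top' (aemeasurable_tsum_enorm_mul g f) h.ne] with x hx
  exact Summable.of_enorm hx.ne

lemma integrable_tsum_mul {g f : ℕ → Rn n →ₘ[volume] ℂ}
    (h : ∫⁻ x, ∑' j, ‖g j x * f j x‖ₑ < ∞) : Integrable fun x => ∑' j, g j x * f j x :=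
  ⟨(AEMeasurable.tsum fun j => ((g j).aestronglyMeasurable.mul
    (f j).aestronglyMeasurable).aemeasurable).aestronglyMeasurable,
    (lintegral_mono fun _ => enorm_tsum_le_tsum_enorm).trans_lt h⟩

lemma enorm_pairing_le (g f : ℕ → Rn n →ₘ[volume] ℂ) :
    ‖pairing g f‖ₑ ≤ ∫⁻ x, ∑' j, ‖g j x * f j x‖ₑ :=
  (enorm_integral_le_lintegral_enorm _).trans (lintegral_mono fun _ => enorm_tsum_le_tsum_enorm)

lemma pairing_comm (g f : ℕ → Rn n →ₘ[volume] ℂ) : pairing g f = pairing f g := by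
  simp only [pairing, mul_comm]

lemma pairing_add_left {g g' f : ℕ → Rn n →ₘ[volume] ℂ}
    (h : ∫⁻ x, ∑' j, ‖g j x * f j x‖ₑ < ∞) (h' : ∫⁻ x, ∑' j, ‖g' j x * f j x‖ₑ < ∞) :
    pairing (g + g') f = pairing g f + pairing g' f := by
  unfold pairing
  rw [← integral_add (integrable_tsum_mul h) (integrable_tsum_mul h')]
  have h1 : ∀ᵐ x, ∀ j, (g j + g' j : Rn n →ₘ[volume] ℂ) x = g j x + g' j x :=
    ae_all_iff.2 fun j => AEEqFun.coeFn_add (g j) (g' j)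
  refine integral_congr_ae ?_
  filter_upwards [h1, ae_summable_mul h, ae_summable_mul h'] with x hx h2 h3
  simp only [Pi.add_apply, hx, add_mul]
  exact h2.tsum_add h3

lemma pairing_smul_left (c : ℂ) (g f : ℕ → Rn n →ₘ[volume] ℂ) :
    pairing (c • g) f = c • pairing g f := by
  unfold pairing
  rw [← integral_smul]
  have h1 : ∀ᵐ x, ∀ j, (c • g j : Rn n →ₘ[volume] ℂ) x = c * g j x :=
    ae_all_iff.2 fun j => AEEqFun.coeFn_smul c (g j)
  refine integral_congr_ae ?_
  filter_upwards [h1] with x hx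
  simp only [Pi.smul_apply, hx, mul_assoc, tsum_mul_left, smul_eq_mul]

variable (hL : MorreyParams n p q r) (hH : PredualParams n p' q' ρ)

lemma lintegral_tsum_enorm_mul_lt_top (hp : p.HolderConjugate p') (hq : q.HolderConjugate q')
    (hρ : r + ρ = -n) (g : MorreySpace hL) (f : PredualSpace hH) :
    ∫⁻ x, ∑' j, ‖(g : ℕ → Rn n →ₘ[volume] ℂ) j x * (f : ℕ → Rn n →ₘ[volume] ℂ) j x‖ₑ < ∞ :=
  (lintegral_tsum_enorm_mul_le hp hq hρ g.2.2).trans_lt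
    (ENNReal.mul_lt_top g.2.2 (PredualSpace.domNorm_lt_top f))

/-- The pairing as a bounded linear map from the Morrey space to the dual of the predual. -/
def pairingCLM (hp : p.HolderConjugate p') (hq : q.HolderConjugate q') (hρ : r + ρ = -n) :
    MorreySpace hL →L[ℂ] StrongDual ℂ (PredualSpace hH) :=
  LinearMap.mkContinuous₂ (LinearMap.mk₂ ℂ (fun (g : MorreySpace hL) (f : PredualSpace hH) =>
      pairing (g : ℕ → Rn n →ₘ[volume] ℂ) (f : ℕ → Rn n →ₘ[volume] ℂ))
    (fun g g' f => pairing_add_left (lintegral_tsum_enorm_mul_lt_top hL hH hp hq hρ g f)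
      (lintegral_tsum_enorm_mul_lt_top hL hH hp hq hρ g' f))
    (fun c g f => pairing_smul_left c _ _)
    (fun g f f' => by
      have h1 := lintegral_tsum_enorm_mul_lt_top hL hH hp hq hρ g f
      have h2 := lintegral_tsum_enorm_mul_lt_top hL hH hp hq hρ g f'
      simp only [mul_comm ((g : ℕ → Rn n →ₘ[volume] ℂ) _ _)] at h1 h2
      simp only [pairing_comm (g : ℕ → Rn n →ₘ[volume] ℂ)]
      exact pairing_add_left h1 h2)
    (fun c g f => by
      simp only [pairing_comm (g : ℕ → Rn n →ₘ[volume] ℂ)]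
      exact pairing_smul_left c _ _)) 1 fun g f => by
    have h1 := (enorm_pairing_le (g : ℕ → Rn n →ₘ[volume] ℂ)
      (f : ℕ → Rn n →ₘ[volume] ℂ)).trans (lintegral_tsum_enorm_mul_le hp hq hρ g.2.2)
    rw [← MorreySpace.enorm_eq, ← PredualSpace.enorm_eq] at h1
    have h2 := ENNReal.toReal_mono (by finiteness) h1
    simpa using h2

lemma enorm_pairingCLM_le (hp : p.HolderConjugate p') (hq : q.HolderConjugate q')
    (hρ : r + ρ = -n) (g : MorreySpace hL) : ‖pairingCLM hL hH hp hq hρ g‖ₑ ≤ ‖g‖ₑ := by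
  refine ContinuousLinearMap.opENorm_le_bound _ fun f => ?_
  rw [MorreySpace.enorm_eq, PredualSpace.enorm_eq]
  exact (enorm_pairing_le _ _).trans (lintegral_tsum_enorm_mul_le hp hq hρ g.2.2)

end

/-! ### Functionals that satisfy dominated convergence -/

section
variable {X : Type*} [MeasurableSpace X] {μ : Measure X}

lemma aeEqFun_add_mul (f g k : X →ₘ[μ] ℂ) : (f + g) * k = f * k + g * k := by
  refine AEEqFun.ext ?_
  filter_upwards [AEEqFun.coeFn_mul (f + g) k, AEEqFun.coeFn_add f g,
    AEEqFun.coeFn_add (f * k) (g * k), AEEqFun.coeFn_mul f k, AEEqFun.coeFn_mul g k]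
    with x h1 h2 h3 h4 h5
  simp only [h1, h2, h3, h4, h5, Pi.add_apply, Pi.mul_apply, add_mul]

lemma aeEqFun_smul_mul (c : ℂ) (f k : X →ₘ[μ] ℂ) : (c • f) * k = c • (f * k) := by
  refine AEEqFun.ext ?_
  filter_upwards [AEEqFun.coeFn_mul (c • f) k, AEEqFun.coeFn_smul c f,
    AEEqFun.coeFn_smul c (f * k), AEEqFun.coeFn_mul f k] with x h1 h2 h3 h4
  simp only [h1, h2, h3, h4, Pi.smul_apply, Pi.mul_apply, smul_mul_assoc]

/-- The class of the indicator function of a measurable set. -/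
def indClass (μ : Measure X) {s : Set X} (hs : MeasurableSet s) : X →ₘ[μ] ℂ :=
  AEEqFun.mk (s.indicator fun _ => (1 : ℂ))
    (stronglyMeasurable_const.indicator hs).aestronglyMeasurable

lemma coeFn_indClass {s : Set X} (hs : MeasurableSet s) :
    indClass μ hs =ᵐ[μ] s.indicator fun _ => (1 : ℂ) := AEEqFun.coeFn_mk _ _

lemma indClass_union {s t : Set X} (hs : MeasurableSet s) (ht : MeasurableSet t)
    (hd : Disjoint s t) : indClass μ (hs.union ht) = indClass μ hs + indClass μ ht := by
  refine AEEqFun.ext ?_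
  filter_upwards [coeFn_indClass (μ := μ) (hs.union ht), coeFn_indClass (μ := μ) hs,
    coeFn_indClass (μ := μ) ht, AEEqFun.coeFn_add (indClass μ hs) (indClass μ ht)]
    with x h1 h2 h3 h4
  rw [h1, h4, Pi.add_apply, h2, h3, Set.indicator_union_of_disjoint hd]

lemma indClass_eq_zero {s : Set X} (hs : MeasurableSet s) (h : μ s = 0) :
    indClass μ hs = 0 := by
  refine AEEqFun.ext ?_
  filter_upwards [coeFn_indClass (μ := μ) hs, AEEqFun.coeFn_zero (α := X) (β := ℂ) (μ := μ),
    measure_eq_zero_iff_ae_notMem.1 h] with x h1 h2 h3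
  rw [h1, h2, Set.indicator_of_notMem h3, Pi.zero_apply]

/-- A functional on classes of functions is boundedly continuous if it respects almost everywhere
convergence of uniformly bounded sequences. -/
def BoundedlyContinuous (l : (X →ₘ[μ] ℂ) →ₗ[ℂ] ℂ) : Prop :=
  ∀ (c : ℝ) (φ : ℕ → X →ₘ[μ] ℂ) (ψ : X →ₘ[μ] ℂ), (∀ m, ∀ᵐ x ∂μ, ‖φ m x‖ ≤ c) →
    (∀ᵐ x ∂μ, Tendsto (fun m => φ m x) atTop (𝓝 (ψ x))) →
    Tendsto (fun m => l (φ m)) atTop (𝓝 (l ψ))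

/-- The set function `s ↦ l 1_s` of a boundedly continuous functional is countably additive. -/
lemma BoundedlyContinuous.exists_complexMeasure {l : (X →ₘ[μ] ℂ) →ₗ[ℂ] ℂ}
    (hl : BoundedlyContinuous l) :
    ∃ ν : ComplexMeasure X, ∀ s (hs : MeasurableSet s), ν s = l (indClass μ hs) := by
  classical
  let a : Set X → ℂ := fun s => if hs : MeasurableSet s then l (indClass μ hs) else 0
  have ha : ∀ s (hs : MeasurableSet s), a s = l (indClass μ hs) := fun s hs => dif_pos hs
  have hempty : a ∅ = 0 := by
    rw [ha ∅ MeasurableSet.empty, indClass_eq_zero _ measure_empty, map_zero]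
  refine ⟨⟨a, hempty, fun s hs => dif_neg hs, fun E hE hd => ?_⟩, ha⟩
  have hU : ∀ t : Finset ℕ, MeasurableSet (⋃ i ∈ t, E i) := fun t =>
    t.measurableSet_biUnion fun i _ => hE i
  have hsum : ∀ t : Finset ℕ, ∑ i ∈ t, a (E i) = l (indClass μ (hU t)) := by
    intro t
    rw [← ha]
    induction t using Finset.induction_on with
    | empty => simpa using hempty.symm
    | insert i t hi ih =>
      have hdis : Disjoint (E i) (⋃ k ∈ t, E k) := by
        refine Set.disjoint_iUnion₂_right.2 fun k hk => hd ?_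
        rintro rfl
        exact hi hk
      rw [Finset.sum_insert hi, ih, Finset.set_biUnion_insert, ha _ (hE i), ha _ (hU t),
        ha _ ((hE i).union (hU t)), indClass_union (hE i) (hU t) hdis, map_add]
  -- unconditional convergence is tested along sequences of finite index sets
  rw [HasSum, SummationFilter.unconditional_filter]
  simp only [hsum]
  rw [ha _ (MeasurableSet.iUnion hE)]
  refine tendsto_of_seq_tendsto fun t ht => hl 1 _ _ (fun m => ?_) ?_
  · filter_upwards [coeFn_indClass (μ := μ) (hU (t m))] with x hx
    rw [hx]
    by_cases h : x ∈ ⋃ i ∈ t m, E i <;> simp [Set.indicator, h]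
  · have h1 : ∀ᵐ x ∂μ, ∀ m, indClass μ (hU (t m)) x =
        (⋃ i ∈ t m, E i).indicator (fun _ => (1 : ℂ)) x :=
      ae_all_iff.2 fun m => coeFn_indClass (μ := μ) (hU (t m))
    filter_upwards [h1, coeFn_indClass (μ := μ) (MeasurableSet.iUnion hE)] with x hx hx'
    simp only [hx, hx']
    by_cases h : x ∈ ⋃ i, E i
    · obtain ⟨i, hi⟩ := Set.mem_iUnion.1 h
      refine tendsto_const_nhds.congr' ?_
      filter_upwards [ht.eventually (eventually_ge_atTop {i})] with m hm
      have h2 : x ∈ ⋃ i ∈ t m, E i := Set.mem_iUnion₂.2 ⟨i, by simpa using hm, hi⟩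
      rw [Set.indicator_of_mem h2, Set.indicator_of_mem h]
    · refine tendsto_const_nhds.congr fun m => ?_
      have h2 : x ∉ ⋃ i ∈ t m, E i := fun h2 => h (Set.iUnion₂_subset_iUnion _ _ h2)
      rw [Set.indicator_of_notMem h2, Set.indicator_of_notMem h]

/-- The Radon–Nikodym theorem for complex measures. -/
lemma exists_setIntegral_eq_of_absolutelyContinuous [SigmaFinite μ] (ν : ComplexMeasure X)
    (h : ∀ s, MeasurableSet s → μ s = 0 → ν s = 0) :
    ∃ f : X → ℂ, Integrable f μ ∧ ∀ s, MeasurableSet s → ν s = ∫ x in s, f x ∂μ := by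
  have hac : VectorMeasure.AbsolutelyContinuous ν μ.toENNRealVectorMeasure :=
    VectorMeasure.AbsolutelyContinuous.mk fun s hs h0 => h s hs (by
      rwa [Measure.toENNRealVectorMeasure_apply_measurable hs] at h0)
  rw [ComplexMeasure.absolutelyContinuous_ennreal_iff] at hac
  set u := ν.re.rnDeriv μ with hu
  set v := ν.im.rnDeriv μ with hv
  have hui : Integrable u μ := SignedMeasure.integrable_rnDeriv _ _
  have hvi : Integrable v μ := SignedMeasure.integrable_rnDeriv _ _
  have hui' : Integrable (fun x => (u x : ℂ)) μ := hui.ofReal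
  have hvi' : Integrable (fun x => (v x : ℂ) * Complex.I) μ := hvi.ofReal.mul_const _
  refine ⟨fun x => u x + v x * Complex.I, hui'.add hvi', fun s hs => ?_⟩
  have h1 : (ν s).re = ∫ x in s, u x ∂μ := by
    rw [← withDensityᵥ_apply hui hs, SignedMeasure.withDensityᵥ_rnDeriv_eq _ μ hac.1]
    rfl
  have h2 : (ν s).im = ∫ x in s, v x ∂μ := by
    rw [← withDensityᵥ_apply hvi hs, SignedMeasure.withDensityᵥ_rnDeriv_eq _ μ hac.2]
    rfl
  rw [integral_add hui'.integrableOn hvi'.integrableOn, integral_mul_const, integral_complex_ofReal,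
    integral_complex_ofReal, ← h1, ← h2]
  exact (Complex.re_add_im (ν s)).symm

/-- A boundedly continuous functional is given by an integrable density. -/
theorem BoundedlyContinuous.exists_integrable [SigmaFinite μ] {l : (X →ₘ[μ] ℂ) →ₗ[ℂ] ℂ}
    (hl : BoundedlyContinuous l) : ∃ f : X → ℂ, Integrable f μ ∧
      ∀ (c : ℝ) (φ : X →ₘ[μ] ℂ), (∀ᵐ x ∂μ, ‖φ x‖ ≤ c) → l φ = ∫ x, φ x * f x ∂μ := by
  obtain ⟨ν, hν⟩ := hl.exists_complexMeasure
  obtain ⟨f, hf, hνf⟩ := exists_setIntegral_eq_of_absolutelyContinuous (μ := μ) ν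
    fun s hs h0 => by rw [hν s hs, indClass_eq_zero hs h0, map_zero]
  have hbdd : ∀ φ : SimpleFunc X ℂ, Integrable (fun x => φ x * f x) μ := by
    intro φ
    obtain ⟨c, hc⟩ := φ.exists_forall_norm_le
    exact hf.bdd_mul φ.aestronglyMeasurable (Eventually.of_forall hc)
  have hsimple : ∀ φ : SimpleFunc X ℂ,
      l (AEEqFun.mk φ φ.aestronglyMeasurable) = ∫ x, φ x * f x ∂μ := by
    intro φ
    induction φ using SimpleFunc.induction with
    | @const c s hs =>
      have h1 : AEEqFun.mk (SimpleFunc.piecewise s hs (SimpleFunc.const X c)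
          (SimpleFunc.const X 0)) (SimpleFunc.aestronglyMeasurable _) = c • indClass μ hs := by
        refine AEEqFun.ext ?_
        refine (AEEqFun.coeFn_mk _ _).trans ?_
        filter_upwards [coeFn_indClass (μ := μ) hs, AEEqFun.coeFn_smul c (indClass μ hs)]
          with x h2 h3
        rw [h3, Pi.smul_apply, h2]
        by_cases hx : x ∈ s <;> simp [hx]
      rw [h1, map_smul, ← hν s hs, hνf s hs, ← integral_indicator hs, smul_eq_mul,
        ← integral_const_mul]
      refine integral_congr_ae (Eventually.of_forall fun x => ?_)
      by_cases hx : x ∈ s <;> simp [hx]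
    | @add φ ψ _ h1 h2 =>
      have h3 : AEEqFun.mk (φ + ψ : SimpleFunc X ℂ) (SimpleFunc.aestronglyMeasurable (μ := μ) _) =
          AEEqFun.mk φ φ.aestronglyMeasurable + AEEqFun.mk ψ ψ.aestronglyMeasurable := by
        rw [AEEqFun.mk_add_mk]
        rfl
      rw [h3, map_add, h1, h2, ← integral_add (hbdd φ) (hbdd ψ)]
      simp [add_mul]
  refine ⟨f, hf, fun c φ hφ => ?_⟩
  -- a negative bound forces `μ = 0`
  rcases lt_or_ge c 0 with hc | hc
  · have h0 : ∀ᵐ _ ∂μ, False := by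
      filter_upwards [hφ] with x hx
      exact absurd (norm_nonneg (φ x)) (by linarith)
    have h1 : φ = 0 := AEEqFun.ext (h0.mono fun _ h => h.elim)
    have h2 : ∫ x, φ x * f x ∂μ = ∫ _, (0 : ℂ) ∂μ := integral_congr_ae (h0.mono fun _ h => h.elim)
    rw [h2, h1, map_zero, integral_zero]
  set s := φ.stronglyMeasurable.approxBounded c with hs
  have hsb : ∀ m x, ‖s m x‖ ≤ c := fun m x =>
    φ.stronglyMeasurable.norm_approxBounded_le hc m x
  have hslim : ∀ᵐ x ∂μ, Tendsto (fun m => s m x) atTop (𝓝 (φ x)) :=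
    φ.stronglyMeasurable.tendsto_approxBounded_ae hφ
  have h1 : Tendsto (fun m => l (AEEqFun.mk (s m) (s m).aestronglyMeasurable)) atTop
      (𝓝 (l φ)) := by
    have h2 : ∀ᵐ x ∂μ, ∀ m, AEEqFun.mk (s m) (s m).aestronglyMeasurable x = s m x :=
      ae_all_iff.2 fun m => AEEqFun.coeFn_mk _ _
    refine hl c _ _ (fun m => ?_) ?_
    · filter_upwards [h2] with x hx
      rw [hx]
      exact hsb m x
    · filter_upwards [h2, hslim] with x hx hx'
      simpa only [hx] using hx'
  have h2 : Tendsto (fun m => ∫ x, s m x * f x ∂μ) atTop (𝓝 (∫ x, φ x * f x ∂μ)) := by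
    refine tendsto_integral_of_dominated_convergence (fun x => c * ‖f x‖)
      (fun m => (hbdd (s m)).1) (hf.norm.const_mul c) (fun m => Eventually.of_forall fun x => ?_) ?_
    · rw [norm_mul]
      gcongr
      exact hsb m x
    · filter_upwards [hslim] with x hx
      exact hx.mul_const _
  simp only [hsimple] at h1
  exact tendsto_nhds_unique h1 h2

end

/-! ### Densities of functionals on the predual -/

section
variable {n : ℕ} {p q ρ : ℝ}

/-- A strictly positive function in the predual. -/
lemma exists_pos_domNorm_lt_top (hP : PredualParams n p q ρ) :
    ∃ w : Rn n → ℝ, Continuous w ∧ (∀ x, 0 < w x) ∧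
      domNorm p ρ (fun x => ENNReal.ofReal (w x)) < ∞ := by
  have hp0 : 0 < p := by linarith [hP.one_lt_p]
  -- `w` decays fast enough to lie in the weighted space of order `α`: `(n + 1) p > n`
  set α : ℝ := -(n / p + ρ) + 1 with hα
  set w : Rn n → ℝ := fun x => (1 + ‖x‖ ^ 2) ^ (-(α + n + 1) / 2) with hw
  have hpos : ∀ x : Rn n, 0 < 1 + ‖x‖ ^ 2 := fun x => by positivity
  have hcont : Continuous w := by
    refine Continuous.rpow_const (by fun_prop) fun x => Or.inl (hpos x).ne'
  refine ⟨w, hcont, fun x => Real.rpow_pos_of_pos (hpos x) _, ?_⟩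
  obtain ⟨C, hC⟩ := exists_domNorm_le_weightedNorm (α := α) hP (by linarith)
  refine (hC _ (hcont.measurable.ennreal_ofReal.aemeasurable)).trans_lt
    (ENNReal.mul_lt_top (by simp) ?_)
  rw [weightedNorm, eLpNorm_ofReal hp0]
  refine ENNReal.rpow_lt_top_of_nonneg (by positivity) (ne_of_lt ?_)
  have hint : Integrable (fun x : Rn n => (1 + ‖x‖ ^ 2) ^ (-((n + 1) * p) / 2)) volume := by
    refine integrable_rpow_neg_one_add_norm_sq ?_
    rw [finrank_euclideanSpace, Fintype.card_fin]
    nlinarith [hP.one_lt_p, (n.cast_nonneg : (0 : ℝ) ≤ n)]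
  refine lt_of_le_of_lt (lintegral_mono fun x => le_of_eq ?_) hint.2
  have h1 : 0 ≤ (1 + ‖x‖ ^ 2) ^ (-((n + 1) * p) / 2) := Real.rpow_nonneg (hpos x).le _
  rw [enorm_eq_self, Real.enorm_of_nonneg h1, ← ENNReal.ofReal_mul (Real.rpow_nonneg (hpos x).le _),
    ← Real.rpow_add (hpos x), ENNReal.ofReal_rpow_of_pos (Real.rpow_pos_of_pos (hpos x) _),
    ← Real.rpow_mul (hpos x).le]
  congr 2
  ring

/-- Bounded functions with bounded support; a single natural number bounds the values and the radius
of the support. -/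
def IsTest (f : Rn n →ₘ[volume] ℂ) : Prop :=
  ∃ N : ℕ, ∀ᵐ x, ‖f x‖ ≤ N ∧ ((N : ℝ) < ‖x‖ → f x = 0)

lemma IsTest.exists_norm_le_mul {f : Rn n →ₘ[volume] ℂ} (hf : IsTest f) {w : Rn n → ℝ}
    (hw : Continuous w) (hw0 : ∀ x, 0 < w x) : ∃ c : ℝ, 0 ≤ c ∧ ∀ᵐ x, ‖f x‖ ≤ c * w x := by
  obtain ⟨N, hN⟩ := hf
  obtain ⟨y, -, hy⟩ := (isCompact_closedBall (0 : Rn n) N).exists_isMinOn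
    ⟨0, by simp⟩ hw.continuousOn
  refine ⟨N / w y, div_nonneg (by positivity) (hw0 y).le, ?_⟩
  filter_upwards [hN] with x hx
  rcases lt_or_ge (N : ℝ) ‖x‖ with h | h
  · rw [hx.2 h, norm_zero]
    exact mul_nonneg (div_nonneg (by positivity) (hw0 y).le) (hw0 x).le
  · have h1 : w y ≤ w x := hy (by simpa using h)
    calc ‖f x‖ ≤ N := hx.1
      _ = N / w y * w y := (div_mul_cancel₀ _ (hw0 y).ne').symm
      _ ≤ _ := by gcongr; exact div_nonneg (by positivity) (hw0 y).le

/-- A functional that is bounded by the majorant norm is given on test functions by a function. -/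
theorem exists_density (hP : PredualParams n p q ρ) {C : ℝ≥0∞} (hC : C ≠ ∞)
    {l : (Rn n →ₘ[volume] ℂ) →ₗ[ℂ] ℂ}
    (hl : ∀ f, domNorm p ρ (fun x => ‖f x‖ₑ) < ∞ → ‖l f‖ₑ ≤ C * domNorm p ρ (fun x => ‖f x‖ₑ)) :
    ∃ g : Rn n →ₘ[volume] ℂ, ∀ f, IsTest f →
      Integrable (fun x => g x * f x) ∧ l f = ∫ x, g x * f x := by
  obtain ⟨w, hw, hw0, hwt⟩ := exists_pos_domNorm_lt_top hP
  have hwc : Continuous fun x => (w x : ℂ) := Complex.continuous_ofReal.comp hw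
  set W : Rn n →ₘ[volume] ℂ := AEEqFun.mk (fun x => (w x : ℂ)) hwc.aestronglyMeasurable with hW
  have hWx : ∀ᵐ x, W x = w x := AEEqFun.coeFn_mk _ _
  have hWn : ∀ᵐ x, ‖W x‖ₑ = ENNReal.ofReal (w x) := by
    filter_upwards [hWx] with x hx
    rw [hx, ← ofReal_norm, Complex.norm_real, Real.norm_of_nonneg (hw0 x).le]
  -- on bounded functions the functional is tested against the positive element `w`
  let lW : (Rn n →ₘ[volume] ℂ) →ₗ[ℂ] ℂ :=
    { toFun := fun φ => l (φ * W)
      map_add' := fun φ ψ => by rw [aeEqFun_add_mul, map_add]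
      map_smul' := fun c φ => by rw [aeEqFun_smul_mul, map_smul, RingHom.id_apply] }
  have hbc : BoundedlyContinuous lW := by
    intro c φ ψ hφ hlim
    have hφ' : ∀ᵐ x, ∀ m, ‖φ m x‖ ≤ c := ae_all_iff.2 hφ
    have hcoe : ∀ᵐ x, ∀ m, ((φ m - ψ) * W : Rn n →ₘ[volume] ℂ) x = (φ m x - ψ x) * W x := by
      refine ae_all_iff.2 fun m => ?_
      filter_upwards [AEEqFun.coeFn_mul (φ m - ψ) W, AEEqFun.coeFn_sub (φ m) ψ] with x h1 h2
      rw [h1, Pi.mul_apply, h2, Pi.sub_apply]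
    have hle : ∀ᵐ x, ∀ m, ‖((φ m - ψ) * W : Rn n →ₘ[volume] ℂ) x‖ₑ ≤
        ‖((2 * c : ℝ) : ℂ)‖ₑ * ENNReal.ofReal (w x) := by
      filter_upwards [hcoe, hφ', hlim, hWn] with x h1 h2 h3 h4 m
      have h5 : ‖ψ x‖ ≤ c := le_of_tendsto' h3.norm h2
      have h6 : ‖φ m x - ψ x‖ ≤ 2 * c := by
        linarith [norm_sub_le (φ m x) (ψ x), h2 m]
      rw [h1 m, enorm_mul, h4]
      gcongr
      rw [enorm_le_iff_norm_le, Complex.norm_real]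
      exact h6.trans (le_abs_self _)
    have hfin : domNorm p ρ (fun x => ‖((2 * c : ℝ) : ℂ)‖ₑ * ENNReal.ofReal (w x)) < ∞ :=
      (domNorm_const_mul_le _ _).trans_lt (ENNReal.mul_lt_top enorm_lt_top hwt)
    have h1 := tendsto_domNorm_of_dominated hP
      (G := fun m x => ‖((φ m - ψ) * W : Rn n →ₘ[volume] ℂ) x‖ₑ)
      (fun m => ((φ m - ψ) * W).aestronglyMeasurable.enorm) hfin
      (fun m => hle.mono fun x hx => hx m) (by
        filter_upwards [hcoe, hlim] with x h1 h2
        have h3 : Tendsto (fun m => (φ m x - ψ x) * W x) atTop (𝓝 0) := by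
          simpa using (h2.sub_const (ψ x)).mul_const (W x)
        simpa only [h1, enorm_zero] using h3.enorm)
    rw [tendsto_iff_edist_tendsto_0]
    have h2 := ENNReal.Tendsto.const_mul h1 (Or.inr hC)
    rw [mul_zero] at h2
    refine tendsto_of_tendsto_of_tendsto_of_le_of_le tendsto_const_nhds h2 (fun _ => zero_le)
      fun m => ?_
    rw [edist_eq_enorm_sub, ← map_sub]
    exact hl _ ((domNorm_mono (hle.mono fun x hx => hx m)).trans_lt hfin)
  obtain ⟨h, hh, hlh⟩ := hbc.exists_integrable
  have hgm : AEStronglyMeasurable (fun x => h x * ((w x)⁻¹ : ℂ)) volume :=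
    hh.1.mul (hwc.inv₀ fun x => by simpa using (hw0 x).ne').aestronglyMeasurable
  refine ⟨AEEqFun.mk _ hgm, fun f hf => ?_⟩
  obtain ⟨c, -, hc⟩ := hf.exists_norm_le_mul hw hw0
  have hφm : AEStronglyMeasurable (fun x => f x * ((w x)⁻¹ : ℂ)) volume :=
    f.aestronglyMeasurable.mul (hwc.inv₀ fun x => by simpa using (hw0 x).ne').aestronglyMeasurable
  have hφx := AEEqFun.coeFn_mk _ hφm
  have hφb : ∀ᵐ x, ‖(AEEqFun.mk _ hφm : Rn n →ₘ[volume] ℂ) x‖ ≤ c := by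
    filter_upwards [hφx, hc] with x h1 h2
    rw [h1, norm_mul, norm_inv, Complex.norm_real, Real.norm_of_nonneg (hw0 x).le]
    exact (div_le_iff₀ (hw0 x)).2 h2
  have hfW : f = AEEqFun.mk _ hφm * W := by
    refine AEEqFun.ext ?_
    filter_upwards [hφx, hWx, AEEqFun.coeFn_mul (AEEqFun.mk _ hφm) W] with x h1 h2 h3
    rw [h3, Pi.mul_apply, h1, h2, mul_assoc, inv_mul_cancel₀ (by simpa using (hw0 x).ne'), mul_one]
  have heq : ∀ᵐ x, (AEEqFun.mk _ hφm : Rn n →ₘ[volume] ℂ) x * h x =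
      (AEEqFun.mk _ hgm : Rn n →ₘ[volume] ℂ) x * f x := by
    filter_upwards [hφx, AEEqFun.coeFn_mk _ hgm] with x h1 h2
    rw [h1, h2]
    ring
  refine ⟨(hh.bdd_mul (AEEqFun.aestronglyMeasurable _) hφb).congr heq, ?_⟩
  have h1 := hlh c _ hφb
  rw [integral_congr_ae heq] at h1
  rw [← h1]
  conv_lhs => rw [hfW]
  rfl

end

/-! ### Test sequences -/

section
variable {n : ℕ} {p p' q q' r ρ α : ℝ}

/-- Sequences with finitely many nonzero members, which are uniformly bounded and have uniformly
bounded supports; a single natural number serves for all three bounds. -/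
def IsTestSeq (f : ℕ → Rn n →ₘ[volume] ℂ) : Prop :=
  ∃ N : ℕ, ∀ᵐ x, ∀ j, ‖f j x‖ ≤ N ∧ ((N : ℝ) < ‖x‖ ∨ N ≤ j → f j x = 0)

lemma IsTestSeq.isTest {f : ℕ → Rn n →ₘ[volume] ℂ} (hf : IsTestSeq f) (j : ℕ) :
    IsTest (f j) := by
  obtain ⟨N, hN⟩ := hf
  exact ⟨N, hN.mono fun x hx => ⟨(hx j).1, fun h => (hx j).2 (Or.inl h)⟩⟩

lemma IsTestSeq.exists_lqNorm_le (hq : 1 < q) {f : ℕ → Rn n →ₘ[volume] ℂ} (hf : IsTestSeq f) :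
    ∃ (c : ℝ≥0∞) (N : ℕ), c ≠ ∞ ∧
      ∀ᵐ x, lqNorm q f x ≤ (Metric.closedBall 0 (N : ℝ)).indicator (fun _ => c) x := by
  have hq0 : 0 < q := by linarith
  obtain ⟨N, hN⟩ := hf
  refine ⟨(N * (N : ℝ≥0∞) ^ q) ^ (1 / q), N, ?_, ?_⟩
  · refine ENNReal.rpow_ne_top_of_nonneg (by positivity) (ENNReal.mul_ne_top (by simp) ?_)
    exact ENNReal.rpow_ne_top_of_nonneg hq0.le (by simp)
  · filter_upwards [hN] with x hx
    by_cases hxN : x ∈ Metric.closedBall (0 : Rn n) (N : ℝ)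
    · rw [Set.indicator_of_mem hxN, lqNorm]
      gcongr
      rw [tsum_eq_sum (s := Finset.range N) fun j hj => by
        rw [(hx j).2 (Or.inr (by simpa using hj)), enorm_zero, ENNReal.zero_rpow_of_pos hq0]]
      refine (Finset.sum_le_card_nsmul _ _ ((N : ℝ≥0∞) ^ q) fun j _ => ?_).trans (by simp)
      gcongr
      have h1 := (hx j).1
      rw [← ofReal_norm, ← ENNReal.ofReal_natCast]
      exact ENNReal.ofReal_le_ofReal h1
    · have h1 : (N : ℝ) < ‖x‖ := by simpa using hxN
      rw [Set.indicator_of_notMem hxN, lqNorm]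
      simp [fun j => (hx j).2 (Or.inl h1), hq0]

lemma weightedNorm_mono {F G : Rn n → ℝ≥0∞} (h : ∀ᵐ x, F x ≤ G x) :
    weightedNorm p α F ≤ weightedNorm p α G := by
  refine eLpNorm_mono_enorm_ae ?_
  filter_upwards [h] with x hx
  simp only [enorm_eq_self]
  gcongr

lemma weightedNorm_indicator_lt_top {c : ℝ≥0∞} (hc : c ≠ ∞) (N : ℕ) :
    weightedNorm p α ((Metric.closedBall (0 : Rn n) (N : ℝ)).indicator fun _ => c) < ∞ := by
  have hcont : Continuous fun x : Rn n => (1 + ‖x‖ ^ 2) ^ (α / 2) :=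
    Continuous.rpow_const (by fun_prop) fun x => Or.inl (by positivity)
  obtain ⟨y, -, hy⟩ := (isCompact_closedBall (0 : Rn n) N).exists_isMaxOn
    ⟨0, by simp⟩ hcont.continuousOn
  set c' : ℝ≥0∞ := ENNReal.ofReal ((1 + ‖y‖ ^ 2) ^ (α / 2)) * c with hc'
  have hct : c' < ∞ := ENNReal.mul_lt_top (by simp) hc.lt_top
  have h1 : weightedNorm p α ((Metric.closedBall (0 : Rn n) (N : ℝ)).indicator fun _ => c) ≤
      eLpNorm ((Metric.closedBall (0 : Rn n) (N : ℝ)).indicator fun _ => c')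
        (ENNReal.ofReal p) volume := by
    refine eLpNorm_mono_enorm_ae (Eventually.of_forall fun x => ?_)
    simp only [enorm_eq_self]
    by_cases hx : x ∈ Metric.closedBall (0 : Rn n) (N : ℝ)
    · rw [Set.indicator_of_mem hx, Set.indicator_of_mem hx]
      exact mul_le_mul_left (ENNReal.ofReal_le_ofReal (hy hx)) c
    · simp [Set.indicator_of_notMem hx]
  refine h1.trans_lt ((eLpNorm_indicator_const_le _ _).trans_lt ?_)
  exact ENNReal.mul_lt_top (by simpa using hct)
    (ENNReal.rpow_lt_top_of_nonneg (by positivity) measure_closedBall_lt_top.ne)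

lemma IsTestSeq.isWeightedSeq (hq : 1 < q) {f : ℕ → Rn n →ₘ[volume] ℂ} (hf : IsTestSeq f) :
    IsWeightedSeq p q α f := by
  obtain ⟨c, N, hc, hN⟩ := hf.exists_lqNorm_le hq
  have h1 : weightedNorm p α (lqNorm q f) < ∞ :=
    (weightedNorm_mono hN).trans_lt (weightedNorm_indicator_lt_top hc N)
  refine ⟨fun j => ?_, h1⟩
  have h2 : weightedNorm p α (f j) = weightedNorm p α (fun x => ‖f j x‖ₑ) := by
    simp [weightedNorm]
  rw [h2]
  exact (weightedNorm_mono (Eventually.of_forall fun x => enorm_le_lqNorm hq f j x)).trans_lt h1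

lemma IsTestSeq.mem_predualSpace (h : PredualParams n p q ρ) {f : ℕ → Rn n →ₘ[volume] ℂ}
    (hf : IsTestSeq f) : f ∈ PredualSpace h := by
  obtain ⟨C, hC⟩ := exists_enorm_le_weightedNorm (α := -(n / p + ρ) + 1) h (by linarith)
  exact (hC f (hf.isWeightedSeq h.one_lt_q)).1

/-! ### Truncation -/

/-- The set on which the `j`-th member of a sequence survives truncation to `S` at height `N`. The
condition involves the `j`-th member alone, so that the set increases with `N`. -/
def truncSet (S : Set (Rn n)) (N : ℕ) (f : ℕ → Rn n →ₘ[volume] ℂ) (j : ℕ) : Set (Rn n) :=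
  {x | x ∈ S ∧ j < N ∧ ‖x‖ ≤ N ∧ ‖f j x‖ ≤ N}

lemma measurableSet_truncSet {S : Set (Rn n)} (hS : MeasurableSet S) (N : ℕ)
    (f : ℕ → Rn n →ₘ[volume] ℂ) (j : ℕ) : MeasurableSet (truncSet S N f j) := by
  refine hS.inter ((MeasurableSet.const _).inter ?_)
  exact (measurableSet_le measurable_norm measurable_const).inter
    (measurableSet_le (f j).stronglyMeasurable.norm.measurable measurable_const)

/-- The truncation of a sequence to the set `S` at height `N`. -/
def truncSeq {S : Set (Rn n)} (hS : MeasurableSet S) (N : ℕ) (f : ℕ → Rn n →ₘ[volume] ℂ) :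
    ℕ → Rn n →ₘ[volume] ℂ := fun j =>
  AEEqFun.mk ((truncSet S N f j).indicator (f j))
    ((f j).stronglyMeasurable.indicator (measurableSet_truncSet hS N f j)).aestronglyMeasurable

lemma coeFn_truncSeq {S : Set (Rn n)} (hS : MeasurableSet S) (f : ℕ → Rn n →ₘ[volume] ℂ) :
    ∀ᵐ x, ∀ N j, truncSeq hS N f j x = (truncSet S N f j).indicator (f j) x :=
  ae_all_iff.2 fun _ => ae_all_iff.2 fun _ => AEEqFun.coeFn_mk _ _

lemma isTestSeq_truncSeq {S : Set (Rn n)} (hS : MeasurableSet S) (N : ℕ)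
    (f : ℕ → Rn n →ₘ[volume] ℂ) : IsTestSeq (truncSeq hS N f) := by
  refine ⟨N, ?_⟩
  filter_upwards [coeFn_truncSeq hS f] with x hx j
  rw [hx]
  by_cases h : x ∈ truncSet S N f j
  · rw [Set.indicator_of_mem h]
    refine ⟨h.2.2.2, fun h1 => ?_⟩
    rcases h1 with h1 | h1
    · exact absurd h.2.2.1 (not_le.2 h1)
    · exact absurd h.2.1 (not_lt.2 h1)
  · rw [Set.indicator_of_notMem h]
    simp

lemma eventually_mem_truncSet {S : Set (Rn n)} {x : Rn n} (hx : x ∈ S)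
    (f : ℕ → Rn n →ₘ[volume] ℂ) (j : ℕ) : ∀ᶠ N in atTop, x ∈ truncSet S N f j := by
  filter_upwards [eventually_gt_atTop j, tendsto_natCast_atTop_atTop.eventually_ge_atTop ‖x‖,
    tendsto_natCast_atTop_atTop.eventually_ge_atTop ‖f j x‖] with N h1 h2 h3
  exact ⟨hx, h1, h2, h3⟩

lemma truncSet_mono (S : Set (Rn n)) (f : ℕ → Rn n →ₘ[volume] ℂ) (j : ℕ) :
    Monotone fun N => truncSet S N f j := by
  intro N M hNM x hx
  have h1 : (N : ℝ) ≤ M := by exact_mod_cast hNM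
  exact ⟨hx.1, hx.2.1.trans_le hNM, hx.2.2.1.trans h1, hx.2.2.2.trans h1⟩

/-- Truncations converge in the predual. -/
lemma tendsto_domNorm_sub_truncSeq (hP : PredualParams n p q ρ) {f : ℕ → Rn n →ₘ[volume] ℂ}
    (hf : domNorm p ρ (lqNorm q f) < ∞) :
    Tendsto (fun N => domNorm p ρ (lqNorm q (f - truncSeq MeasurableSet.univ N f))) atTop
      (𝓝 0) := by
  have hq0 : 0 < q := by linarith [hP.one_lt_q]
  have hsub : ∀ᵐ x, ∀ N j, (f - truncSeq MeasurableSet.univ N f) j x =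
      (truncSet Set.univ N f j)ᶜ.indicator (f j) x := by
    have h1 : ∀ᵐ x, ∀ N j, (f j - truncSeq MeasurableSet.univ N f j : Rn n →ₘ[volume] ℂ) x =
        f j x - truncSeq MeasurableSet.univ N f j x :=
      ae_all_iff.2 fun _ => ae_all_iff.2 fun _ => AEEqFun.coeFn_sub _ _
    filter_upwards [h1, coeFn_truncSeq MeasurableSet.univ f] with x hx hx' N j
    rw [Pi.sub_apply, hx, hx']
    by_cases h : x ∈ truncSet Set.univ N f j <;> simp [Set.indicator, h]
  refine tendsto_domNorm_of_dominated hP (fun N => aemeasurable_lqNorm q _) hf (fun N => ?_) ?_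
  · filter_upwards [hsub] with x hx
    unfold lqNorm
    gcongr with j
    rw [hx]
    exact enorm_indicator_le_enorm_self _ _
  · filter_upwards [hsub, ae_lt_top_of_domNorm hP (aemeasurable_lqNorm q f) hf] with x hx hxt
    have hfin : ∑' j, ‖f j x‖ₑ ^ q ≠ ∞ := by
      intro h
      rw [lqNorm, h, ENNReal.top_rpow_of_pos (by positivity)] at hxt
      exact hxt.ne rfl
    have h1 := tendsto_lintegral_of_dominated_convergence (μ := Measure.count (α := ℕ))
      (F := fun N j => ‖(f - truncSeq MeasurableSet.univ N f) j x‖ₑ ^ q) (f := fun _ => 0)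
      (fun j => ‖f j x‖ₑ ^ q) (fun _ => measurable_of_countable _)
      (fun N => Eventually.of_forall fun j => ?_) (by rwa [lintegral_count])
      (Eventually.of_forall fun j => ?_)
    · simp only [lintegral_count, tsum_zero] at h1
      have h2 := ((ENNReal.continuous_rpow_const (y := 1 / q)).tendsto 0).comp h1
      rwa [ENNReal.zero_rpow_of_pos (by positivity)] at h2
    · change ‖(f - truncSeq MeasurableSet.univ N f) j x‖ₑ ^ q ≤ ‖f j x‖ₑ ^ q
      gcongr
      rw [hx]
      exact enorm_indicator_le_enorm_self _ _
    · refine tendsto_const_nhds.congr' ?_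
      filter_upwards [eventually_mem_truncSet (Set.mem_univ x) f j] with N hN
      rw [hx, Set.indicator_of_notMem (by simpa using hN), enorm_zero,
        ENNReal.zero_rpow_of_pos hq0]

/-- Test sequences are dense in the predual: functionals that agree on them are equal. -/
lemma eq_of_eq_on_isTestSeq {h : PredualParams n p q ρ} {T T' : StrongDual ℂ (PredualSpace h)}
    (hT : ∀ f : PredualSpace h, IsTestSeq (f : ℕ → Rn n →ₘ[volume] ℂ) → T f = T' f) :
    T = T' := by
  ext f
  set s : ℕ → PredualSpace h := fun N =>
    ⟨truncSeq MeasurableSet.univ N f, (isTestSeq_truncSeq _ N _).mem_predualSpace h⟩ with hs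
  have hlim : Tendsto s atTop (𝓝 f) := by
    rw [tendsto_iff_edist_tendsto_0]
    refine (tendsto_domNorm_sub_truncSeq h (PredualSpace.domNorm_lt_top f)).congr fun N => ?_
    rw [edist_comm, edist_eq_enorm_sub, PredualSpace.enorm_eq]
    rfl
  have h1 := (T.continuous.tendsto f).comp hlim
  have h2 := (T'.continuous.tendsto f).comp hlim
  have h3 : T ∘ s = T' ∘ s := funext fun N => hT _ (isTestSeq_truncSeq MeasurableSet.univ N _)
  rw [h3] at h1
  exact tendsto_nhds_unique h1 h2

/-! ### Extremal sequences and the norm estimate -/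

/-- The value at one point of the sequence `conj(a_j) |a_j|^{q-2} L^{p-q}`, for which equality holds
in Hölder's inequality in `L_p(ℓ_q)` if `L = ‖a | ℓ_q‖`. Where `a_j = 0` the value is `0` whatever
the conventions for powers of `0`. -/
def extremal (p q : ℝ) (a : ℕ → ℂ) (L : ℝ) (j : ℕ) : ℂ :=
  conj (a j) * ((‖a j‖ ^ (q - 2) * L ^ (p - q) : ℝ) : ℂ)

lemma mul_extremal (hq : 1 < q) (a : ℕ → ℂ) (L : ℝ) (j : ℕ) :
    a j * extremal p q a L j = ((‖a j‖ ^ q * L ^ (p - q) : ℝ) : ℂ) := by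
  rcases eq_or_ne (a j) 0 with h0 | h0
  · simp [extremal, h0, Real.zero_rpow (show q ≠ 0 by linarith)]
  · have h1 : 0 < ‖a j‖ := norm_pos_iff.2 h0
    rw [extremal, ← mul_assoc, Complex.mul_conj, ← Complex.ofReal_mul, Complex.normSq_eq_norm_sq,
      ← mul_assoc, ← Real.rpow_natCast, ← Real.rpow_add h1]
    norm_num

lemma norm_extremal (hq : 1 < q) (a : ℕ → ℂ) {L : ℝ} (hL : 0 ≤ L) (j : ℕ) :
    ‖extremal p q a L j‖ = ‖a j‖ ^ (q - 1) * L ^ (p - q) := by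
  rcases eq_or_ne (a j) 0 with h0 | h0
  · simp [extremal, h0, Real.zero_rpow (show q - 1 ≠ 0 by linarith)]
  · have h1 : 0 < ‖a j‖ := norm_pos_iff.2 h0
    rw [extremal, norm_mul, RCLike.norm_conj, Complex.norm_real, Real.norm_of_nonneg (by positivity),
      ← mul_assoc]
    nth_rw 1 [← Real.rpow_one ‖a j‖]
    rw [← Real.rpow_add h1]
    ring_nf

lemma tsum_mul_extremal (hp : 1 < p) (hq : 1 < q) {a : ℕ → ℂ} {L : ℝ≥0∞}
    (hL : L = (∑' j, ‖a j‖ₑ ^ q) ^ (1 / q)) (hLt : L ≠ ∞) :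
    ∑' j, a j * extremal p q a L.toReal j = (((L ^ p).toReal : ℝ) : ℂ) := by
  have hq0 : 0 < q := by linarith
  have hLq : ∑' j, ‖a j‖ₑ ^ q = L ^ q := by
    rw [hL, ← ENNReal.rpow_mul, one_div_mul_cancel hq0.ne', ENNReal.rpow_one]
  have hsum : ∑' j, ‖a j‖ ^ q = L.toReal ^ q := by
    rw [ENNReal.toReal_rpow, ← hLq, ENNReal.tsum_toReal_eq fun j =>
      ENNReal.rpow_ne_top_of_nonneg hq0.le enorm_ne_top]
    simp only [← ENNReal.toReal_rpow, toReal_enorm]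
  simp only [mul_extremal hq]
  rw [← Complex.ofReal_tsum, tsum_mul_right, hsum, ← ENNReal.toReal_rpow]
  congr 1
  rcases eq_or_ne L 0 with h0 | h0
  · simp [h0, Real.zero_rpow hq0.ne', Real.zero_rpow (show p ≠ 0 by linarith)]
  · rw [← Real.rpow_add (ENNReal.toReal_pos h0 hLt)]
    ring_nf

lemma tsum_enorm_extremal (hp : 1 < p) (hq : q.HolderConjugate q') {a : ℕ → ℂ} {L : ℝ≥0∞}
    (hL : L = (∑' j, ‖a j‖ₑ ^ q) ^ (1 / q)) (hLt : L ≠ ∞) :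
    (∑' j, ‖extremal p q a L.toReal j‖ₑ ^ q') ^ (1 / q') = L ^ (p - 1) := by
  have hq0 : 0 < q := hq.pos
  have hq0' : 0 < q' := hq.symm.pos
  have hLq : ∑' j, ‖a j‖ₑ ^ q = L ^ q := by
    rw [hL, ← ENNReal.rpow_mul, one_div_mul_cancel hq0.ne', ENNReal.rpow_one]
  rcases eq_or_ne L 0 with h0 | h0
  · rw [h0, ENNReal.zero_rpow_of_pos hq0, ENNReal.tsum_eq_zero] at hLq
    have ha : ∀ j, a j = 0 := fun j => by simpa [hq0, hq0.le] using hLq j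
    rw [h0, ENNReal.zero_rpow_of_pos (by linarith)]
    simp [extremal, ha, hq0']
  · have h1 : ∀ j, ‖extremal p q a L.toReal j‖ₑ = ‖a j‖ₑ ^ (q - 1) * L ^ (p - q) := by
      intro j
      rw [← ofReal_norm, norm_extremal hq.lt a ENNReal.toReal_nonneg,
        ENNReal.ofReal_mul (by positivity), ENNReal.toReal_rpow,
        ENNReal.ofReal_toReal (ENNReal.rpow_ne_top_of_ne_zero h0 hLt),
        ← ENNReal.ofReal_rpow_of_nonneg (norm_nonneg _) (by linarith [hq.lt]), ofReal_norm]
    have h2 : (q - 1) * q' = q := hq.sub_one_mul_conj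
    simp only [h1, ENNReal.mul_rpow_of_nonneg _ _ hq0'.le, ← ENNReal.rpow_mul, h2]
    rw [ENNReal.tsum_mul_right, hLq, ENNReal.mul_rpow_of_nonneg _ _ (by positivity),
      ← ENNReal.rpow_mul, ← ENNReal.rpow_mul, ← ENNReal.rpow_add _ _ h0 hLt]
    congr 1
    field_simp
    linarith

end

section
variable {n : ℕ} {p p' q q' r ρ α : ℝ}

lemma scale_mul_scale_of_conj (hp : p.HolderConjugate p') (hρ : r + ρ = -n) (J : ℤ) :
    scale J (n / p + r) * scale J (n / p' + ρ) = 1 := by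
  have h1 : (n : ℝ) / p + n / p' = n := by
    rw [div_eq_mul_inv, div_eq_mul_inv, ← mul_add, hp.inv_add_inv_eq_one, mul_one]
  rw [show (n : ℝ) / p' + ρ = -(n / p + r) by linarith, scale_mul_scale_neg]

/-- The norm of a truncation `h` of `g` is bounded by testing `g` against the extremal sequence `f` of
`h`: with `I = ∫ ‖h | ℓ_q‖^p` the pairing is `I`, while the norm of `f` in the predual is at most
`2^{J(n/p'+ρ)} I^{1/p'}`. -/
lemma scale_mul_eLpNorm_le_of_isTestSeq (hp : p.HolderConjugate p') (hq : q.HolderConjugate q')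
    (hρ : r + ρ = -n) {g h : ℕ → Rn n →ₘ[volume] ℂ} {C : ℝ≥0∞}
    (hg : ∀ f, IsTestSeq f → ‖pairing g f‖ₑ ≤ C * domNorm p' ρ (lqNorm q' f))
    (hh : IsTestSeq h) (hgh : ∀ᵐ x, ∀ j, h j x = 0 ∨ h j x = g j x) {i : Idx n}
    (hi : ∀ᵐ x, ∀ j, x ∉ cube i → h j x = 0) :
    scale i.1 (n / p + r) * eLpNorm (lqNorm q h) (ENNReal.ofReal p) volume ≤ C := by
  have hp0 : 0 < p := hp.pos
  have hq0 : 0 < q := hq.pos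
  set L : Rn n → ℝ≥0∞ := lqNorm q h with hL
  have hLm : AEMeasurable L := aemeasurable_lqNorm q h
  obtain ⟨c, N, hc, hN⟩ := hh.exists_lqNorm_le hq.lt
  have hLc : ∀ᵐ x, L x ≤ c := by
    filter_upwards [hN] with x hx
    exact hx.trans (Set.indicator_le_self _ _ _)
  have hLt : ∀ᵐ x, L x ≠ ∞ := hLc.mono fun x hx => ne_top_of_le_ne_top hc hx
  have hfm : ∀ j, AEStronglyMeasurable
      (fun x => extremal p q (fun j => h j x) (L x).toReal j) volume := fun j =>
    (Complex.continuous_conj.comp_aestronglyMeasurable (h j).aestronglyMeasurable).mul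
      (Complex.measurable_ofReal.comp_aemeasurable
        (((h j).aestronglyMeasurable.norm.aemeasurable.pow_const _).mul
          (hLm.ennreal_toReal.pow_const _))).aestronglyMeasurable
  set f : ℕ → Rn n →ₘ[volume] ℂ := fun j => AEEqFun.mk _ (hfm j) with hf
  have hfx : ∀ᵐ x, ∀ j, f j x = extremal p q (fun j => h j x) (L x).toReal j :=
    ae_all_iff.2 fun j => AEEqFun.coeFn_mk _ (hfm j)
  have hf0 : ∀ x j, h j x = 0 → extremal p q (fun j => h j x) (L x).toReal j = 0 :=
    fun x j h0 => by simp [extremal, h0]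
  have hfL : ∀ᵐ x, lqNorm q' f x = L x ^ (p - 1) := by
    filter_upwards [hfx, hLt] with x hx hxt
    simp only [lqNorm, hx]
    exact tsum_enorm_extremal hp.lt hq rfl hxt
  have hft : IsTestSeq f := by
    obtain ⟨M, hM⟩ := hh
    have hct : c ^ (p - 1) ≠ ∞ := ENNReal.rpow_ne_top_of_nonneg (by linarith [hp.lt]) hc
    obtain ⟨K, hK⟩ := exists_nat_ge (c ^ (p - 1)).toReal
    refine ⟨max M K, ?_⟩
    filter_upwards [hM, hfx, hfL, hLc] with x h1 h2 h3 h4 j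
    constructor
    · have h5 : ‖f j x‖ₑ ≤ c ^ (p - 1) := by
        refine (enorm_le_lqNorm hq.symm.lt f j x).trans ?_
        rw [h3]
        exact ENNReal.rpow_le_rpow h4 (by linarith [hp.lt])
      have h6 := ENNReal.toReal_mono hct h5
      rw [toReal_enorm] at h6
      refine h6.trans (hK.trans ?_)
      exact_mod_cast le_max_right M K
    · intro h5
      rw [h2]
      refine hf0 x j ((h1 j).2 ?_)
      refine h5.imp (fun h6 => lt_of_le_of_lt ?_ h6) fun h6 => (le_max_left M K).trans h6
      exact_mod_cast le_max_left M K
  set I : ℝ≥0∞ := ∫⁻ x, L x ^ p with hI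
  have hIt : I ≠ ∞ := by
    have h1 : I ≤ ∫⁻ x, (Metric.closedBall (0 : Rn n) (N : ℝ)).indicator (fun _ => c ^ p) x := by
      refine lintegral_mono_ae ?_
      filter_upwards [hN] with x hx
      by_cases hxN : x ∈ Metric.closedBall (0 : Rn n) (N : ℝ)
      · rw [Set.indicator_of_mem hxN] at hx ⊢
        exact ENNReal.rpow_le_rpow hx hp0.le
      · rw [Set.indicator_of_notMem hxN] at hx ⊢
        rw [show L x = 0 from nonpos_iff_eq_zero.1 hx, ENNReal.zero_rpow_of_pos hp0]
    rw [lintegral_indicator_const Metric.isClosed_closedBall.measurableSet] at h1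
    exact (h1.trans_lt (ENNReal.mul_lt_top
      (ENNReal.rpow_lt_top_of_nonneg hp0.le hc) measure_closedBall_lt_top)).ne
  have hpair : ‖pairing g f‖ₑ = I := by
    have h1 : pairing g f = ∫ x, (((L x ^ p).toReal : ℝ) : ℂ) := by
      refine integral_congr_ae ?_
      filter_upwards [hfx, hgh, hLt] with x h1 h2 h3
      refine Eq.trans (tsum_congr fun j => ?_)
        (tsum_mul_extremal (a := fun j => h j x) (L := L x) hp.lt hq.lt rfl h3)
      rw [h1]
      rcases h2 j with h4 | h4
      · rw [hf0 x j h4, mul_zero, mul_zero]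
      · rw [h4]
    rw [h1, integral_complex_ofReal, integral_toReal (hLm.pow_const p)
      (hLt.mono fun x hx => ENNReal.rpow_lt_top_of_nonneg hp0.le hx), ← ofReal_norm,
      Complex.norm_real, Real.norm_of_nonneg ENNReal.toReal_nonneg, ENNReal.ofReal_toReal hIt]
  have hdom : domNorm p' ρ (lqNorm q' f) ≤ scale i.1 (n / p' + ρ) * I ^ (1 / p') := by
    rw [domNorm_congr hfL]
    refine (domNorm_le_of_cube i (hLm.pow_const _) ?_).trans (le_of_eq ?_)
    · filter_upwards [hi] with x hx hxi
      have h1 : L x = 0 := by simp [hL, lqNorm, fun j => hx j hxi, hq0]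
      rw [h1, ENNReal.zero_rpow_of_pos (by linarith [hp.lt])]
    · rw [eLpNorm_ofReal hp.symm.pos]
      simp only [← ENNReal.rpow_mul, hp.sub_one_mul_conj]
      rfl
  have hmain : I ≤ C * (scale i.1 (n / p' + ρ) * I ^ (1 / p')) := by
    calc I = ‖pairing g f‖ₑ := hpair.symm
      _ ≤ _ := hg f hft
      _ ≤ _ := mul_le_mul_right hdom _
  rw [eLpNorm_ofReal hp0]
  change _ * I ^ (1 / p) ≤ C
  rcases eq_or_ne I 0 with h0 | h0
  · rw [h0, ENNReal.zero_rpow_of_pos (by positivity), mul_zero]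
    exact zero_le
  · have hsplit : I ^ (1 / p) * I ^ (1 / p') = I := by
      rw [← ENNReal.rpow_add _ _ h0 hIt, one_div, one_div, hp.inv_add_inv_eq_one,
        ENNReal.rpow_one]
    have hpos : I ^ (1 / p') ≠ 0 := by simp [ENNReal.rpow_eq_zero_iff, h0, hIt]
    have htop : I ^ (1 / p') ≠ ∞ := ENNReal.rpow_ne_top_of_ne_zero h0 hIt
    -- `I` is finite, so that the factor `I^(1/p')` can be cancelled
    refine (ENNReal.mul_le_mul_iff_left hpos htop).1 ?_
    calc scale i.1 (n / p + r) * I ^ (1 / p) * I ^ (1 / p')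
        = scale i.1 (n / p + r) * I := by rw [mul_assoc, hsplit]
      _ ≤ scale i.1 (n / p + r) * (C * (scale i.1 (n / p' + ρ) * I ^ (1 / p'))) := by gcongr
      _ = (scale i.1 (n / p + r) * scale i.1 (n / p' + ρ)) * (C * I ^ (1 / p')) := by ring
      _ = _ := by rw [scale_mul_scale_of_conj hp hρ, one_mul]

/-- The converse of Hölder's inequality: the Morrey norm is the supremum over test sequences. -/
theorem morreyNorm_le_of_pairing_le (hp : p.HolderConjugate p') (hq : q.HolderConjugate q')
    (hρ : r + ρ = -n) {g : ℕ → Rn n →ₘ[volume] ℂ} {C : ℝ≥0∞}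
    (hg : ∀ f, IsTestSeq f → ‖pairing g f‖ₑ ≤ C * domNorm p' ρ (lqNorm q' f)) :
    morreyNorm p r (lqNorm q g) ≤ C := by
  have hp0 : 0 < p := hp.pos
  have hq0 : 0 < q := hq.pos
  refine iSup_le fun i => ?_
  set h : ℕ → ℕ → Rn n →ₘ[volume] ℂ := fun N => truncSeq (measurableSet_cube i) N g with hh
  have hhx := coeFn_truncSeq (measurableSet_cube i) g
  have hle : ∀ N, scale i.1 (n / p + r) *
      eLpNorm (lqNorm q (h N)) (ENNReal.ofReal p) volume ≤ C := by
    intro N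
    refine scale_mul_eLpNorm_le_of_isTestSeq hp hq hρ hg (isTestSeq_truncSeq _ N g) ?_ ?_
    · filter_upwards [hhx] with x hx j
      rw [hx]
      exact Set.indicator_eq_zero_or_self _ _ _
    · filter_upwards [hhx] with x hx j hxi
      rw [hx]
      exact Set.indicator_of_notMem (fun h1 => hxi h1.1) _
  have hmono : ∀ᵐ x, Monotone fun N => lqNorm q (h N) x := by
    filter_upwards [hhx] with x hx N M hNM
    unfold lqNorm
    simp only [hh, hx]
    gcongr with j
    simp only [enorm_indicator_eq_indicator_enorm]
    refine Set.indicator_le_indicator_of_subset (truncSet_mono _ g j hNM) (fun _ => ?_) x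
    exact zero_le
  have hlim : ∀ᵐ x, x ∈ cube i →
      Tendsto (fun N => lqNorm q (h N) x) atTop (𝓝 (lqNorm q g x)) := by
    filter_upwards [hhx] with x hx hxi
    have h1 := lintegral_tendsto_of_tendsto_of_monotone (μ := Measure.count (α := ℕ))
      (f := fun N j => ‖h N j x‖ₑ ^ q) (F := fun j => ‖g j x‖ₑ ^ q)
      (fun N => (measurable_of_countable _).aemeasurable)
      (Eventually.of_forall fun j N M hNM => ?_) (Eventually.of_forall fun j => ?_)
    · simp only [lintegral_count] at h1
      exact ((ENNReal.continuous_rpow_const (y := 1 / q)).tendsto _).comp h1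
    · simp only [hh, hx, enorm_indicator_eq_indicator_enorm]
      refine ENNReal.rpow_le_rpow ?_ hq0.le
      refine Set.indicator_le_indicator_of_subset (truncSet_mono _ g j hNM) (fun _ => ?_) x
      exact zero_le
    · refine tendsto_const_nhds.congr' ?_
      filter_upwards [eventually_mem_truncSet hxi g j] with N hN
      simp only [hh, hx]
      rw [Set.indicator_of_mem hN]
  have h1 : Tendsto (fun N => ∫⁻ x in cube i, lqNorm q (h N) x ^ p) atTop
      (𝓝 (∫⁻ x in cube i, lqNorm q g x ^ p)) := by
    refine lintegral_tendsto_of_tendsto_of_monotone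
      (fun N => ((aemeasurable_lqNorm q _).pow_const p).restrict) (ae_restrict_of_ae ?_)
      ((ae_restrict_iff' (measurableSet_cube i)).2 ?_)
    · filter_upwards [hmono] with x hx N M hNM
      exact ENNReal.rpow_le_rpow (hx hNM) hp0.le
    · filter_upwards [hlim] with x hx hxi
      exact ((ENNReal.continuous_rpow_const (y := p)).tendsto _).comp (hx hxi)
  have h2 := ENNReal.Tendsto.const_mul
    (((ENNReal.continuous_rpow_const (y := 1 / p)).tendsto _).comp h1)
    (Or.inr (scale_ne_top i.1 (n / p + r)))
  rw [eLpNorm_ofReal hp0]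
  refine le_of_tendsto' h2 fun N => le_trans ?_ (hle N)
  rw [Function.comp_apply, ← eLpNorm_ofReal hp0]
  gcongr
  exact Measure.restrict_le_self

/-! ### Representation of functionals -/

/-- A finite Morrey norm implies local integrability, since bounded sets lie in cubes. -/
lemma isMorrey_of_morreyNorm_lt_top {g : Rn n →ₘ[volume] ℂ} (hg : morreyNorm p r g < ∞) :
    IsMorrey p r g := by
  refine ⟨fun K _ hb => ⟨g.aestronglyMeasurable.restrict, ?_⟩, hg⟩
  obtain ⟨R, hR⟩ := hb.subset_closedBall 0
  obtain ⟨m, hm⟩ := pow_unbounded_of_one_lt R (one_lt_two (α := ℝ))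
  have hK : K ⊆ cube (-(m : ℤ), 0) := by
    intro x hx k
    have h1 : ‖x‖ ≤ R := by simpa using hR hx
    have h2 : |x k| ≤ 2 ^ m := (PiLp.norm_apply_le x k).trans (h1.trans hm.le)
    simpa [abs_le] using h2
  have h1 : scale (-(m : ℤ)) (n / p + r) *
      eLpNorm g (ENNReal.ofReal p) (volume.restrict (cube (-(m : ℤ), 0))) < ∞ :=
    (le_iSup (fun i : Idx n => scale i.1 (n / p + r) *
      eLpNorm g (ENNReal.ofReal p) (volume.restrict (cube i))) (-(m : ℤ), 0)).trans_lt hg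
  refine (eLpNorm_mono_measure _ (Measure.restrict_mono hK le_rfl)).trans_lt ?_
  refine lt_top_iff_ne_top.2 fun h2 => h1.ne ?_
  rw [h2, ENNReal.mul_top (scale_ne_zero _ _)]

lemma isMorreySeq_of_morreyNorm_lt_top (hq : 1 < q) {g : ℕ → Rn n →ₘ[volume] ℂ}
    (hg : morreyNorm p r (lqNorm q g) < ∞) : IsMorreySeq p q r g :=
  ⟨fun j => isMorrey_of_morreyNorm_lt_top ((morreyNorm_mono (Eventually.of_forall fun x => by
    simpa using enorm_le_lqNorm hq g j x)).trans_lt hg), hg⟩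

/-- Every bounded functional on the predual is, on test sequences, the pairing with a sequence. -/
lemma exists_eq_pairing (h : PredualParams n p q ρ) (T : StrongDual ℂ (PredualSpace h)) :
    ∃ g : ℕ → Rn n →ₘ[volume] ℂ, ∀ f : PredualSpace h,
      IsTestSeq (f : ℕ → Rn n →ₘ[volume] ℂ) → T f = pairing g f := by
  have hq0 : 0 < q := by linarith [h.one_lt_q]
  -- a linear extension of `T` to all sequences, which need not be bounded
  obtain ⟨Λ, hΛ⟩ := LinearMap.exists_extend (T : PredualSpace h →ₗ[ℂ] ℂ)
  have hΛT : ∀ f : PredualSpace h, Λ (f : ℕ → Rn n →ₘ[volume] ℂ) = T f := fun f =>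
    LinearMap.congr_fun hΛ f
  have hsingle : ∀ (j : ℕ) (φ : Rn n →ₘ[volume] ℂ),
      ∀ᵐ x, lqNorm q (Pi.single j φ : ℕ → Rn n →ₘ[volume] ℂ) x = ‖φ x‖ₑ := by
    intro j φ
    filter_upwards [AEEqFun.coeFn_zero (α := Rn n) (β := ℂ) (μ := volume)] with x hx
    rw [lqNorm, tsum_eq_single j]
    · rw [Pi.single_eq_same, ← ENNReal.rpow_mul, mul_one_div_cancel hq0.ne', ENNReal.rpow_one]
    · intro k hk
      rw [Pi.single_eq_of_ne hk, hx]
      simp [hq0]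
  have hdens : ∀ j, ∃ g : Rn n →ₘ[volume] ℂ, ∀ φ, IsTest φ →
      Integrable (fun x => g x * φ x) ∧
        Λ (Pi.single j φ : ℕ → Rn n →ₘ[volume] ℂ) = ∫ x, g x * φ x := by
    intro j
    refine exists_density h (C := ‖T‖ₑ) enorm_ne_top
      (l := Λ ∘ₗ LinearMap.single ℂ (fun _ : ℕ => Rn n →ₘ[volume] ℂ) j) fun φ hφ => ?_
    have h1 := domNorm_congr (p := p) (ρ := ρ) (hsingle j φ)
    have hmem : (Pi.single j φ : ℕ → Rn n →ₘ[volume] ℂ) ∈ PredualSpace h :=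
      (isPredualSeq_iff h _).2 (by rwa [h1])
    have h2 := T.le_opENorm ⟨_, hmem⟩
    rw [PredualSpace.enorm_eq, ← hΛT] at h2
    rwa [← h1]
  choose g hg using hdens
  refine ⟨g, fun f hf => ?_⟩
  obtain ⟨N, hN⟩ := id hf
  have hfz : ∀ j, N ≤ j → (f : ℕ → Rn n →ₘ[volume] ℂ) j = 0 := fun j hj => by
    refine AEEqFun.ext ?_
    filter_upwards [hN, AEEqFun.coeFn_zero (α := Rn n) (β := ℂ) (μ := volume)] with x hx h0
    rw [h0, (hx j).2 (Or.inr hj), Pi.zero_apply]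
  have hfs : (f : ℕ → Rn n →ₘ[volume] ℂ) =
      ∑ j ∈ Finset.range N, Pi.single j ((f : ℕ → Rn n →ₘ[volume] ℂ) j) := by
    funext k
    rw [Finset.sum_apply]
    by_cases hk : k < N
    · rw [Finset.sum_eq_single k]
      · rw [Pi.single_eq_same]
      · intro j _ hj
        rw [Pi.single_eq_of_ne hj.symm]
      · intro hk'
        exact absurd (Finset.mem_range.2 hk) hk'
    · rw [Finset.sum_eq_zero, hfz k (not_lt.1 hk)]
      intro j hj
      rw [Pi.single_eq_of_ne]
      rintro rfl
      exact hk (Finset.mem_range.1 hj)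
  rw [← hΛT, pairing]
  conv_lhs => rw [hfs]
  rw [map_sum, Finset.sum_congr rfl fun j _ => (hg j _ (hf.isTest j)).2,
    ← integral_finsetSum _ fun j _ => (hg j _ (hf.isTest j)).1]
  refine integral_congr_ae ?_
  filter_upwards [hN] with x hx
  refine (tsum_eq_sum fun j hj => ?_).symm
  rw [(hx j).2 (Or.inr (by simpa using hj)), mul_zero]

variable (hL : MorreyParams n p q r) (hH : PredualParams n p' q' ρ)

lemma norm_pairingCLM (hp : p.HolderConjugate p') (hq : q.HolderConjugate q')
    (hρ : r + ρ = -n) (g : MorreySpace hL) : ‖pairingCLM hL hH hp hq hρ g‖ = ‖g‖ := by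
  have h : ‖pairingCLM hL hH hp hq hρ g‖ₑ = ‖g‖ₑ := by
    refine le_antisymm (enorm_pairingCLM_le hL hH hp hq hρ g) ?_
    rw [MorreySpace.enorm_eq]
    refine morreyNorm_le_of_pairing_le hp hq hρ fun f hf => ?_
    have h1 := (pairingCLM hL hH hp hq hρ g).le_opENorm ⟨f, hf.mem_predualSpace hH⟩
    rwa [PredualSpace.enorm_eq] at h1
  rw [← toReal_enorm, h, toReal_enorm]

lemma pairingCLM_surjective (hp : p.HolderConjugate p') (hq : q.HolderConjugate q')
    (hρ : r + ρ = -n) : Function.Surjective (pairingCLM hL hH hp hq hρ) := by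
  intro T
  obtain ⟨g, hg⟩ := exists_eq_pairing hH T
  have h1 : morreyNorm p r (lqNorm q g) ≤ ‖T‖ₑ := by
    refine morreyNorm_le_of_pairing_le hp hq hρ fun f hf => ?_
    have h2 := T.le_opENorm ⟨f, hf.mem_predualSpace hH⟩
    rwa [PredualSpace.enorm_eq, hg _ hf] at h2
  have hgL : IsMorreySeq p q r g :=
    isMorreySeq_of_morreyNorm_lt_top hq.lt (h1.trans_lt enorm_lt_top)
  exact ⟨⟨g, hgL⟩, eq_of_eq_on_isTestSeq fun f hf => (hg f hf).symm⟩

/-- The isometric isomorphism of the Morrey space onto the dual of the predual. -/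
def pairingEquiv (hp : p.HolderConjugate p') (hq : q.HolderConjugate q') (hρ : r + ρ = -n) :
    MorreySpace hL ≃ₗᵢ[ℂ] StrongDual ℂ (PredualSpace hH) :=
  LinearIsometryEquiv.ofSurjective
    ⟨(pairingCLM hL hH hp hq hρ : MorreySpace hL →ₗ[ℂ] StrongDual ℂ (PredualSpace hH)),
      norm_pairingCLM hL hH hp hq hρ⟩ (pairingCLM_surjective hL hH hp hq hρ)

lemma pairingEquiv_apply (hp : p.HolderConjugate p') (hq : q.HolderConjugate q')
    (hρ : r + ρ = -n) (g : MorreySpace hL) (f : PredualSpace hH) :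
    pairingEquiv hL hH hp hq hρ g f = pairing (g : ℕ → Rn n →ₘ[volume] ℂ) f := rfl

/-- A functional represented by `g` on the weighted space is represented by `g` everywhere, because
test sequences lie in the weighted space. -/
lemma eq_pairingEquiv_iff (hp : p.HolderConjugate p') (hq : q.HolderConjugate q')
    (hρ : r + ρ = -n) (T : StrongDual ℂ (PredualSpace hH)) (g : MorreySpace hL) :
    T = pairingEquiv hL hH hp hq hρ g ↔ ∀ f : PredualSpace hH,
      IsWeightedSeq p' q' α (f : ℕ → Rn n →ₘ[volume] ℂ) →
        T f = pairing (g : ℕ → Rn n →ₘ[volume] ℂ) f :=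
  ⟨fun h f _ => by rw [h, pairingEquiv_apply], fun h =>
    eq_of_eq_on_isTestSeq fun f hf => h f (hf.isWeightedSeq hq.symm.lt)⟩

end

lemma isLUB_norm_apply {E : Type*} [NormedAddCommGroup E] [NormedSpace ℂ E]
    (T : StrongDual ℂ E) : IsLUB {t : ℝ | ∃ x : E, ‖x‖ ≤ 1 ∧ t = ‖T x‖} ‖T‖ := by
  refine ⟨?_, fun b hb => ?_⟩
  · rintro _ ⟨x, hx, rfl⟩
    exact T.unit_le_opNorm x hx
  · have h0 : 0 ≤ b := hb ⟨0, by simp, by simp⟩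
    rw [← T.sSup_unitClosedBall_eq_norm]
    refine Real.sSup_le ?_ h0
    rintro _ ⟨x, hx, rfl⟩
    exact hb ⟨x, by simpa using hx, rfl⟩

end MorreyDual

end

open MorreyDual MeasureTheory
theorem mainTheorem2 (n : ℕ) (p p' q q' r ρ : ℝ) (hp : 1 < p) (hq : 1 < q)
    (hpp' : p.HolderConjugate p') (hqq' : q.HolderConjugate q')
    (hr : -(n / p) < r) (hr0 : r < 0) (hρ : r + ρ = -n) :
    letI L := MorreySpace (MorreyParams.of_lt hp hq hr hr0)
    letI H := PredualSpace (PredualParams.of_conj hpp' hqq' hr hr0 hρ)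
    -- `H` is a Banach space whose dual is isometrically isomorphic to `L` through the pairing,
    -- whose integral converges absolutely
    CompleteSpace H ∧
    (∀ (g : L) (f : H), ∫⁻ x, ∑' j, ‖(g : ℕ → Rn n →ₘ[volume] ℂ) j x *
      (f : ℕ → Rn n →ₘ[volume] ℂ) j x‖ₑ < ⊤) ∧
    (∃ Φ : L ≃ₗᵢ[ℂ] StrongDual ℂ H, ∀ (g : L) (f : H), Φ g f = pairing (n := n) g f) ∧
    -- representation of the functionals on the weighted space `L_{p'}(ℓ_{q'}, w_α)`, `α > n/p`
    (∀ α : ℝ, n / p < α →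
      -- the continuous embedding of the weighted space into `H`
      (∃ C : NNReal, ∀ f : ℕ → Rn n →ₘ[volume] ℂ, IsWeightedSeq (n := n) p' q' α f →
        ∃ hf : f ∈ H, ‖(⟨f, hf⟩ : H)‖ₑ ≤ C * weightedNorm p' α (lqNorm q' f)) ∧
      -- every bounded functional has a unique representation, with equal norms
      (∀ T : StrongDual ℂ H, ∃! g : L, ∀ f : H, IsWeightedSeq (n := n) p' q' α f → T f = pairing (n := n) g f) ∧
      -- every `g` in `L` represents a unique bounded functional
      (∀ g : L, ∃! T : StrongDual ℂ H, ∀ f : H, IsWeightedSeq (n := n) p' q' α f → T f = pairing (n := n) g f) ∧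
      (∀ (T : StrongDual ℂ H) (g : L),
        (∀ f : H, IsWeightedSeq (n := n) p' q' α f → T f = pairing (n := n) g f) → ‖T‖ = ‖g‖)) ∧
    -- the norm formula
    (∀ g : L, IsLUB {t : ℝ | ∃ f : H, ‖f‖ ≤ 1 ∧ t = ‖pairing (n := n) g f‖} ‖g‖) := by
  have hL := MorreyParams.of_lt hp hq hr hr0
  have hH := PredualParams.of_conj hpp' hqq' hr hr0 hρ
  refine ⟨PredualSpace.completeSpace hH, lintegral_tsum_enorm_mul_lt_top hL hH hpp' hqq' hρ,
    ⟨pairingEquiv hL hH hpp' hqq' hρ, pairingEquiv_apply hL hH hpp' hqq' hρ⟩, fun α hα => ?_,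
    fun g => ?_⟩
  · have key := eq_pairingEquiv_iff (α := α) hL hH hpp' hqq' hρ
    refine ⟨exists_enorm_le_weightedNorm hH ?_, fun T => ?_, fun g => ?_, fun T g hTg => ?_⟩
    · have h1 : (n : ℝ) / p + n / p' = n := by
        rw [div_eq_mul_inv, div_eq_mul_inv, ← mul_add, hpp'.inv_add_inv_eq_one, mul_one]
      linarith
    · refine ⟨(pairingEquiv hL hH hpp' hqq' hρ).symm T, (key _ _).1 (by simp), fun g hg => ?_⟩
      rw [(key T g).2 hg, LinearIsometryEquiv.symm_apply_apply]
    · exact ⟨pairingEquiv hL hH hpp' hqq' hρ g, (key _ _).1 rfl, fun T hT => (key T g).2 hT⟩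
    · rw [(key T g).2 hTg, LinearIsometryEquiv.norm_map]
  · have h1 := isLUB_norm_apply (pairingEquiv hL hH hpp' hqq' hρ g)
    rwa [LinearIsometryEquiv.norm_map] at h1
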